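/- Let $1\le p\le\infty$, $\alpha>0$ and $m\ge 1$ (real). For $p<\infty$ let $\mathcal F^p_{(\alpha,m)}$ be the space of entire functions $f$ with $$\|f\|_{(p,\alpha,m)}=\Big(\int_{\mathbb C}|f(z)|^p e^{-p\alpha|z|^m}\,dA(z)\Big)^{1/p}<\infty ,$$ where $dA$ is Lebesgue area measure, and let $\mathcal F^\infty_{(\alpha,m)}$ be the space of entire functions $f$ with $$\|f\|_{(\infty,\alpha,m)}=\sup_{r>0}e^{-\alpha r^m}\sup_{|z|=r}|f(z)|<\infty .$$ A bounded operator $T$ on a Banach space is called power bounded if $\sup_{n\ge 0}\|T^n\|<\infty$, quasi-nilpotent if $\lim_{n\to\infty}\|T^n\|^{1/n}=0$, and uniformly mean ergodic if the means $\frac1n\sum_{k=1}^nT^k$ converge in operator norm as $n\to\infty$. The integration operator $Jf(z)=\int_0^z f(w)\,dw$ is a bounded operator on $\mathcal F^p_{(\alpha,m)}$, and: 1. If $m>1$ and $1\le p\le\infty$, then $J$ is compact, quasi-nilpotent, power bounded and uniformly mean ergodic. 2. If $m=1$ and $p=\infty$, then $J$ is power bounded if and only if $\alpha\ge 1$. 3.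 If $m=1$ and $p=\infty$, then $J$ is uniformly mean ergodic if and only if $\alpha>1$. 4. If $m=1$, $1\le p<\infty$ and $J$ is power bounded, then $\alpha\ge 1$. 5. If $m=1$, $1\le p<\infty$ and $J$ is power bounded and uniformly mean ergodic, then $\alpha>1$. -/

import Mathlib

open MeasureTheory Filter Topology
open scoped ENNReal

noncomputable section

/-- The (extended) norm of the generalized Fock space: for `p < ∞` it is
`(∫ |f z| ^ p * exp (-p α |z| ^ m) dA(z)) ^ (1 / p)`, with `dA` the Lebesgue area measure, and
for `p = ∞` it is the supremum over `z ≠ 0` (that is, over all circles of radius `r > 0`) of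
`exp (-α |z| ^ m) |f z|`. -/
def fockENorm (p : ℝ≥0∞) (α m : ℝ) (f : ℂ → ℂ) : ℝ≥0∞ :=
  if p = ∞ then
    ⨆ (z : ℂ) (_ : z ≠ 0), ENNReal.ofReal (Real.exp (-(α * ‖z‖ ^ m)) * ‖f z‖)
  else
    (∫⁻ z : ℂ, ENNReal.ofReal (‖f z‖ ^ p.toReal * Real.exp (-(p.toReal * α * ‖z‖ ^ m))))
      ^ (1 / p.toReal)

/-- The weighted function `exp (-α |z| ^ m) f z`. -/
def fockWeighted (α m : ℝ) (f : ℂ → ℂ) : ℂ → ℂ :=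
  fun z => (Real.exp (-(α * ‖z‖ ^ m)) : ℂ) * f z

theorem norm_fockWeighted (α m : ℝ) (f : ℂ → ℂ) (z : ℂ) :
    ‖fockWeighted α m f z‖ = Real.exp (-(α * ‖z‖ ^ m)) * ‖f z‖ := by
  rw [fockWeighted, norm_mul, Complex.norm_real, Real.norm_eq_abs, Real.abs_exp]

theorem aestronglyMeasurable_fockWeighted (α m : ℝ) {f : ℂ → ℂ} (hf : Continuous f) :
    AEStronglyMeasurable (fockWeighted α m f) volume := by
  have h : Measurable (fockWeighted α m f) := by
    unfold fockWeighted
    have := hf.measurable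
    fun_prop
  exact h.aestronglyMeasurable

/-- For continuous functions the norm above is an `L^p` norm. -/
theorem fockENorm_eq_eLpNorm {p : ℝ≥0∞} (hp : p ≠ 0) (α m : ℝ) {f : ℂ → ℂ}
    (hf : Continuous f) :
    fockENorm p α m f = eLpNorm (fockWeighted α m f) p volume := by
  unfold fockENorm
  split_ifs with h
  · subst h
    rw [eLpNorm_exponent_top]
    apply le_antisymm
    · refine iSup₂_le fun z hz => ?_
      by_contra! hlt
      rw [← norm_fockWeighted, ofReal_norm] at hlt
      have hcont : ContinuousAt (fun w => ‖fockWeighted α m f w‖ₑ) z := by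
        refine ContinuousAt.enorm ?_
        unfold fockWeighted
        have h1 : ContinuousAt (fun w : ℂ => ‖w‖ ^ m) z :=
          continuous_norm.continuousAt.rpow_const (Or.inl (norm_ne_zero_iff.mpr hz))
        have h2 : ContinuousAt (fun w : ℂ => Real.exp (-(α * ‖w‖ ^ m))) z :=
          Real.continuous_exp.continuousAt.comp (h1.const_mul α).neg
        exact (Complex.continuous_ofReal.continuousAt.comp h2).mul hf.continuousAt
      have hnhds := hcont.eventually (lt_mem_nhds hlt)
      have hpos := Measure.measure_pos_of_mem_nhds (volume : Measure ℂ) hnhds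
      have hzero : volume {w : ℂ | ¬ ‖fockWeighted α m f w‖ₑ
          ≤ eLpNormEssSup (fockWeighted α m f) volume} = 0 :=
        enorm_ae_le_eLpNormEssSup (fockWeighted α m f) volume
      simp only [not_le] at hzero
      exact hpos.ne' hzero
    · refine essSup_le_of_ae_le _ ?_
      have h0 : ∀ᵐ z : ℂ, z ≠ 0 := by simp [ae_iff]
      filter_upwards [h0] with z hz
      rw [← ofReal_norm, norm_fockWeighted]
      exact le_iSup₂ (f := fun (z : ℂ) (_ : z ≠ 0) =>
        ENNReal.ofReal (Real.exp (-(α * ‖z‖ ^ m)) * ‖f z‖)) z hz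
  · rw [eLpNorm_eq_lintegral_rpow_enorm_toReal hp h]
    congr 1
    refine lintegral_congr fun z => ?_
    rw [← ofReal_norm, norm_fockWeighted,
      ENNReal.ofReal_rpow_of_nonneg (by positivity) ENNReal.toReal_nonneg,
      Real.mul_rpow (by positivity) (norm_nonneg _), ← Real.exp_mul, mul_comm]
    congr 3
    ring

theorem fockWeighted_add (α m : ℝ) (f g : ℂ → ℂ) :
    fockWeighted α m (f + g) = fockWeighted α m f + fockWeighted α m g := by
  ext z; simp [fockWeighted, mul_add]

theorem fockWeighted_smul (α m : ℝ) (c : ℂ) (f : ℂ → ℂ) :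
    fockWeighted α m (c • f) = c • fockWeighted α m f := by
  ext z; simp [fockWeighted]; ring

theorem fockWeighted_zero (α m : ℝ) : fockWeighted α m 0 = 0 := by
  ext z; simp [fockWeighted]

section Space

variable (p : ℝ≥0∞) [hp : Fact (1 ≤ p)] (α m : ℝ)

theorem fockENorm_zero : fockENorm p α m 0 = 0 := by
  rw [fockENorm_eq_eLpNorm (zero_lt_one.trans_le hp.out).ne' α m continuous_zero,
    fockWeighted_zero, eLpNorm_zero]

theorem fockENorm_add_le {f g : ℂ → ℂ} (hf : Continuous f) (hg : Continuous g) :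
    fockENorm p α m (f + g) ≤ fockENorm p α m f + fockENorm p α m g := by
  have h0 := (zero_lt_one.trans_le hp.out).ne'
  rw [fockENorm_eq_eLpNorm h0 α m hf, fockENorm_eq_eLpNorm h0 α m hg,
    fockENorm_eq_eLpNorm h0 α m (hf.add hg), fockWeighted_add]
  exact eLpNorm_add_le (aestronglyMeasurable_fockWeighted α m hf)
    (aestronglyMeasurable_fockWeighted α m hg) hp.out

theorem fockENorm_smul (c : ℂ) {f : ℂ → ℂ} (hf : Continuous f) :
    fockENorm p α m (c • f) = ‖c‖ₑ * fockENorm p α m f := by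
  have h0 := (zero_lt_one.trans_le hp.out).ne'
  rw [fockENorm_eq_eLpNorm h0 α m hf, fockENorm_eq_eLpNorm h0 α m (hf.const_smul c),
    fockWeighted_smul, eLpNorm_const_smul]

theorem eq_zero_of_fockENorm_eq_zero {f : ℂ → ℂ} (hf : Continuous f)
    (h : fockENorm p α m f = 0) : f = 0 := by
  have h0 := (zero_lt_one.trans_le hp.out).ne'
  rw [fockENorm_eq_eLpNorm h0 α m hf,
    eLpNorm_eq_zero_iff (aestronglyMeasurable_fockWeighted α m hf) h0] at h
  refine Continuous.ae_eq_iff_eq (volume : Measure ℂ) hf continuous_zero |>.mp ?_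
  filter_upwards [h] with z hz
  simpa [fockWeighted] using hz

/-- The entire functions with finite norm, as a linear subspace of all functions `ℂ → ℂ`. -/
def fockSubmodule : Submodule ℂ (ℂ → ℂ) where
  carrier := {f | Differentiable ℂ f ∧ fockENorm p α m f < ∞}
  zero_mem' := ⟨differentiable_const 0, by rw [fockENorm_zero]; exact ENNReal.zero_lt_top⟩
  add_mem' := fun {_ _} hf hg => ⟨hf.1.add hg.1,
    (fockENorm_add_le p α m hf.1.continuous hg.1.continuous).trans_lt
      (ENNReal.add_lt_top.mpr ⟨hf.2, hg.2⟩)⟩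
  smul_mem' := fun c _ hf => ⟨hf.1.const_smul c, by
    rw [fockENorm_smul p α m c hf.1.continuous]
    exact ENNReal.mul_lt_top enorm_lt_top hf.2⟩

/-- The generalized Fock space `F^p_(α,m)`, `1 ≤ p ≤ ∞`: all entire functions `f` with
`fockENorm p α m f < ∞`. It is a type of its own, so that it carries its norm topology and
not the topology of pointwise convergence. -/
def FockSpace : Type := fockSubmodule p α m

instance : AddCommGroup (FockSpace p α m) :=
  inferInstanceAs (AddCommGroup (fockSubmodule p α m))

instance : Module ℂ (FockSpace p α m) :=
  inferInstanceAs (Module ℂ (fockSubmodule p α m))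

instance : CoeFun (FockSpace p α m) (fun _ => ℂ → ℂ) := ⟨fun f => f.1⟩

/-- The norm on `F^p_(α,m)`. -/
instance : NormedAddCommGroup (FockSpace p α m) :=
  AddGroupNorm.toNormedAddCommGroup
    { toFun := fun f => (fockENorm p α m f).toReal
      map_zero' := by
        change (fockENorm p α m 0).toReal = 0
        rw [fockENorm_zero, ENNReal.toReal_zero]
      add_le' := fun f g => by
        change (fockENorm p α m (f.1 + g.1)).toReal ≤ _
        rw [← ENNReal.toReal_add f.2.2.ne g.2.2.ne]
        exact ENNReal.toReal_mono (ENNReal.add_lt_top.mpr ⟨f.2.2, g.2.2⟩).ne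
          (fockENorm_add_le p α m f.2.1.continuous g.2.1.continuous)
      neg' := fun f => by
        change (fockENorm p α m (-f.1)).toReal = _
        rw [← neg_one_smul ℂ f.1, fockENorm_smul p α m _ f.2.1.continuous]
        simp
      eq_zero_of_map_eq_zero' := fun f hf => by
        rcases (ENNReal.toReal_eq_zero_iff _).mp hf with h | h
        · exact Subtype.ext (eq_zero_of_fockENorm_eq_zero p α m f.2.1.continuous h)
        · exact absurd h f.2.2.ne }

theorem FockSpace.norm_def (f : FockSpace p α m) : ‖f‖ = (fockENorm p α m f).toReal := rfl

instance : NormedSpace ℂ (FockSpace p α m) where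
  norm_smul_le c f := by
    change (fockENorm p α m (c • f.1)).toReal ≤ ‖c‖ * (fockENorm p α m f.1).toReal
    rw [fockENorm_smul p α m c f.2.1.continuous, ENNReal.toReal_mul, toReal_enorm]

end Space

/-- The integration operator on functions, `f ↦ (z ↦ ∫_0^z f(w) dw)`, the integral being taken
along the segment `w = t z`, `0 ≤ t ≤ 1` (for entire `f` the path does not matter). -/
def integrationOp (f : ℂ → ℂ) (z : ℂ) : ℂ :=
  ∫ t in (0 : ℝ)..1, f ((t : ℂ) * z) * z

section Operators

variable {X : Type*} [NormedAddCommGroup X] [NormedSpace ℂ X]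

/-- `T` is power bounded: the norms of its powers are bounded by some `M > 0`. -/
def IsPowerBounded (T : X →L[ℂ] X) : Prop :=
  ∃ M : ℝ, 0 < M ∧ ∀ n : ℕ, ‖T ^ n‖ ≤ M

/-- `T` is quasi-nilpotent: `‖T ^ n‖ ^ (1 / n) → 0`. -/
def IsQuasiNilpotent (T : X →L[ℂ] X) : Prop :=
  Tendsto (fun n : ℕ => ‖T ^ n‖ ^ (1 / (n : ℝ))) atTop (𝓝 0)

/-- `T` is uniformly mean ergodic: the means `(1 / n) ∑_{k=1}^n T ^ k` converge in the operator
norm to a continuous linear operator. -/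
def IsUniformlyMeanErgodic (T : X →L[ℂ] X) : Prop :=
  ∃ P : X →L[ℂ] X,
    Tendsto (fun n : ℕ => ((n : ℂ)⁻¹) • ∑ k ∈ Finset.Icc 1 n, T ^ k) atTop (𝓝 P)

end Operators

end

/-!
Write `φ = α |z| ^ m` and `J` for the integration operator. The upper bounds come from one
estimate on rays. On the ray through `z` one has `|J f (r ω)| ≤ ∫_0^r |f (s ω)| ds`, and for a weight
`exp (-ψ)` whose exponent satisfies `ψ(r) - ψ(s) ≥ β (r - s)` the weighted moduli of `f` and `J f`
are related by the convolution kernel `exp (-β (r - s))`. A Schur test on the half line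
(`lintegral_rpow_exp_neg_le`) shows that this kernel has norm at most `rayConst β`, which tends to
`0` as `β → ∞`, in `L^p((1 + r) dr dθ)`, that is, in `L^p((1 + 1 / |z|) dA)` (`rayNorm_le`). On
entire functions the additional mass `1 / |z|` near the origin gives an equivalent norm, because
point evaluations are bounded (`exists_rayNorm_le_mul_fockENorm`).

If `m > 1`, every `β` is allowed: `ψ = φ + β min(r, R)` has slope at least `β` once `R` is so large
that `α r ^ (m - 1) ≥ β` for `r ≥ R`, and it differs from `φ` by a bounded amount. Hence
`‖J ^ n‖ ≤ C_β (rayConst β) ^ n` (`exists_norm_pow_le`), which gives quasi-nilpotence and summability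
of `‖J ^ n‖`, and with it power boundedness and convergence of the means to `0`. The same weights show
that `J f` is small when `f` is bounded in norm and small on a large disc
(`fockENorm_integrationOp_le`), so compactness follows from Montel's theorem. For `m ≥ 1` the
choice `β = α`, `R = 1` shows that `J` is bounded, and for `m = 1`, `p = ∞` the choice `β = α`, `R = 0`
gives the sharp bound `‖J‖ ≤ 1 / α`.

For the lower bounds let `m = 1`. Then `|f z| ≤ C exp (α |z|) ‖f‖`. Power boundedness, and also
convergence of the means, forces `‖J ^ n‖ ≤ C (n + 1)`; as `J ^ n 1 = z ^ n / n!`, summation against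
`l ^ n` with `l < 1` yields `exp (l r) ≤ C exp (α r)`, so `α ≥ 1` (`one_le_of_norm_pow_le`). If
`α = 1` and the means converge in norm, then their limit is `0`, since `J` has no nonzero fixed
point, and therefore `1 - J` is bounded below. The functions `exp (l z)` and `z exp (l z)` with `l → 1`
contradict this (`not_isUniformlyMeanErgodic_of_eq_one`).
-/

/-! ### A Schur test on the half line -/

theorem lintegral_exp_neg_mul_Ici {γ : ℝ} (hγ : 0 < γ) :
    ∫⁻ u in Set.Ici (0 : ℝ), ENNReal.ofReal (Real.exp (-(γ * u))) = ENNReal.ofReal (1 / γ) := by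
  rw [← setLIntegral_congr Ioi_ae_eq_Ici]
  have h := integral_exp_mul_Ioi (a := -γ) (by linarith) 0
  have hi := integrableOn_exp_mul_Ioi (a := -γ) (by linarith) 0
  simp only [neg_mul] at h hi
  rw [← ofReal_integral_eq_lintegral_ofReal hi (ae_of_all _ fun u => (Real.exp_pos _).le), h]
  simp

theorem lintegral_exp_neg_mul_sub_Ioc_le {β : ℝ} (hβ : 0 < β) (r : ℝ) :
    ∫⁻ s in Set.Ioc 0 r, ENNReal.ofReal (Real.exp (-(β * (r - s)))) ≤ ENNReal.ofReal (1 / β) := by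
  rw [← lintegral_exp_neg_mul_Ici hβ, ← lintegral_indicator measurableSet_Ioc,
    ← lintegral_indicator measurableSet_Ici, ← lintegral_sub_left_eq_self _ r]
  refine lintegral_mono fun u => ?_
  by_cases hu : r - u ∈ Set.Ioc 0 r
  · rw [Set.indicator_of_mem hu, Set.indicator_of_mem (by simpa using hu.2)]
    simp
  · rw [Set.indicator_of_notMem hu]
    exact zero_le

theorem one_add_mul_exp_le {β : ℝ} (hβ : 0 < β) {u : ℝ} (hu : 0 ≤ u) :
    (1 + u) * Real.exp (-(β * u)) ≤ (1 + 2 / β) * Real.exp (-(β / 2 * u)) := by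
  have h1 : Real.exp (-(β * u)) = Real.exp (-(β / 2 * u)) * Real.exp (-(β / 2 * u)) := by
    rw [← Real.exp_add]; ring_nf
  have h2 : (1 + u) * Real.exp (-(β / 2 * u)) ≤ 1 + 2 / β := by
    rw [Real.exp_neg, ← div_eq_mul_inv, div_le_iff₀ (Real.exp_pos _)]
    have h3 := Real.add_one_le_exp (β / 2 * u)
    have h4 : u = 2 / β * (β / 2 * u) := by field_simp
    have h5 : 0 ≤ β / 2 * u := by positivity
    have h6 : 0 < 2 / β := by positivity
    nlinarith
  rw [h1, ← mul_assoc]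
  gcongr

/-- The norm bound for the convolution operator with kernel `exp (-β u)` on the half line. It
tends to `0` as `β → ∞`. -/
noncomputable def rayConst (β : ℝ) : ℝ := 2 / β * (1 + 2 / β)

theorem rayConst_pos {β : ℝ} (hβ : 0 < β) : 0 < rayConst β := by unfold rayConst; positivity

theorem inv_le_rayConst {β : ℝ} (hβ : 0 < β) : 1 / β ≤ rayConst β := by
  unfold rayConst
  have : 0 < 1 / β := by positivity
  have h2 : 2 / β = 2 * (1 / β) := by ring
  rw [h2]; nlinarith

theorem tendsto_rayConst : Tendsto rayConst atTop (𝓝 0) := by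
  have h : Tendsto (fun β : ℝ => 2 / β) atTop (𝓝 0) := tendsto_const_nhds.div_atTop tendsto_id
  have h2 := h.mul (h.const_add 1)
  rw [zero_mul] at h2
  exact h2

theorem lintegral_exp_neg_mul_sub_Ici_le {β : ℝ} (hβ : 0 < β) {s : ℝ} (hs : 0 ≤ s) :
    ∫⁻ r in Set.Ici s, ENNReal.ofReal (Real.exp (-(β * (r - s)))) * ENNReal.ofReal (1 + r)
      ≤ ENNReal.ofReal (rayConst β) * ENNReal.ofReal (1 + s) := by
  have hβ2 : 0 < β / 2 := by positivity
  rw [← lintegral_indicator measurableSet_Ici, ← lintegral_add_left_eq_self _ s]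
  calc _ ≤ ∫⁻ u, (Set.Ici (0 : ℝ)).indicator (fun u => ENNReal.ofReal ((1 + s) * (1 + 2 / β)) *
          ENNReal.ofReal (Real.exp (-(β / 2 * u)))) u := by
        refine lintegral_mono fun u => ?_
        by_cases hu0 : 0 ≤ u
        swap
        · rw [Set.indicator_of_notMem (by simpa using hu0)]
          exact zero_le
        rw [Set.indicator_of_mem (by simpa using hu0), Set.indicator_of_mem (by simpa using hu0),
          ← ENNReal.ofReal_mul (Real.exp_pos _).le,
          ← ENNReal.ofReal_mul (by positivity)]
        refine ENNReal.ofReal_le_ofReal ?_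
        calc Real.exp (-(β * (s + u - s))) * (1 + (s + u))
            ≤ Real.exp (-(β * u)) * ((1 + s) * (1 + u)) := by
              rw [add_sub_cancel_left]; gcongr; nlinarith [mul_nonneg hs hu0]
          _ = (1 + s) * ((1 + u) * Real.exp (-(β * u))) := by ring
          _ ≤ (1 + s) * ((1 + 2 / β) * Real.exp (-(β / 2 * u))) := by
              gcongr ?_ * ?_; exact one_add_mul_exp_le hβ hu0
          _ = _ := by ring
    _ = _ := by
        rw [lintegral_indicator measurableSet_Ici, lintegral_const_mul _ (by fun_prop),
          lintegral_exp_neg_mul_Ici hβ2, ← ENNReal.ofReal_mul (by positivity),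
          ← ENNReal.ofReal_mul (rayConst_pos hβ).le]
        congr 1
        unfold rayConst
        field_simp

/-- Jensen's inequality for the kernel `exp (-β (r - s))` on `(0, r]`, whose total mass is at
most `1 / β`. -/
theorem rpow_lintegral_exp_neg_le {β q : ℝ} (hβ : 0 < β) (hq : 1 ≤ q) {H : ℝ → ℝ≥0∞}
    (hH : Measurable H) (r : ℝ) :
    (∫⁻ s in Set.Ioc 0 r, ENNReal.ofReal (Real.exp (-(β * (r - s)))) * H s) ^ q
      ≤ ENNReal.ofReal (1 / β) ^ (q - 1) *
        ∫⁻ s in Set.Ioc 0 r, ENNReal.ofReal (Real.exp (-(β * (r - s)))) * H s ^ q := by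
  have hq0 : 0 < q := by linarith
  set k : ℝ → ℝ≥0∞ := fun s => ENNReal.ofReal (Real.exp (-(β * (r - s)))) with hk
  have hkm : Measurable k := by fun_prop
  set ν : Measure ℝ := (volume.restrict (Set.Ioc 0 r)).withDensity k with hν
  have e1 : ∀ G : ℝ → ℝ≥0∞, Measurable G → ∫⁻ s in Set.Ioc 0 r, k s * G s = ∫⁻ s, G s ∂ν :=
    fun G hG => by rw [hν, lintegral_withDensity_eq_lintegral_mul _ hkm hG]; rfl
  have hmass : ν Set.univ ≤ ENNReal.ofReal (1 / β) := by
    rw [hν, withDensity_apply _ MeasurableSet.univ, Measure.restrict_univ]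
    exact lintegral_exp_neg_mul_sub_Ioc_le hβ r
  have h := eLpNorm'_le_eLpNorm'_mul_rpow_measure_univ (μ := ν) (f := H) one_pos hq
    hH.aestronglyMeasurable
  simp only [eLpNorm', enorm_eq_self, ENNReal.rpow_one, div_one] at h
  change (∫⁻ s in Set.Ioc 0 r, k s * H s) ^ q ≤ _ * ∫⁻ s in Set.Ioc 0 r, k s * H s ^ q
  rw [e1 H hH, e1 (fun s => H s ^ q) (hH.pow_const q)]
  calc (∫⁻ s, H s ∂ν) ^ q
      ≤ ((∫⁻ s, H s ^ q ∂ν) ^ (1 / q) * ν Set.univ ^ (1 - 1 / q)) ^ q := by gcongr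
    _ = ν Set.univ ^ (q - 1) * ∫⁻ s, H s ^ q ∂ν := by
        rw [ENNReal.mul_rpow_of_nonneg _ _ hq0.le, ← ENNReal.rpow_mul, ← ENNReal.rpow_mul,
          one_div_mul_cancel hq0.ne', ENNReal.rpow_one, mul_comm]
        congr 2
        field_simp
    _ ≤ _ := by
        gcongr

/-- The Schur test for the kernel `exp (-β (r - s))`, `0 < s ≤ r`, in the space
`L^q((1 + r) dr)`. The weight `1 + r` rather than `r` makes the column integrals comparable
with the weight itself down to `s = 0`. -/
theorem lintegral_rpow_exp_neg_le {β q : ℝ} (hβ : 0 < β) (hq : 1 ≤ q) {H : ℝ → ℝ≥0∞}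
    (hH : Measurable H) :
    ∫⁻ r in Set.Ioi (0 : ℝ),
        (∫⁻ s in Set.Ioc 0 r, ENNReal.ofReal (Real.exp (-(β * (r - s)))) * H s) ^ q
          * ENNReal.ofReal (1 + r)
      ≤ ENNReal.ofReal (rayConst β) ^ q *
        ∫⁻ s in Set.Ioi (0 : ℝ), H s ^ q * ENNReal.ofReal (1 + s) := by
  set E : ℝ → ℝ → ℝ≥0∞ := fun r s => ENNReal.ofReal (Real.exp (-(β * (r - s)))) with hE
  have hEm : Measurable fun x : ℝ × ℝ => E x.1 x.2 := by simp only [hE]; fun_prop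
  have hset : MeasurableSet {x : ℝ × ℝ | 0 < x.2 ∧ x.2 ≤ x.1} :=
    (measurableSet_lt measurable_const measurable_snd).inter
      (measurableSet_le measurable_snd measurable_fst)
  set T : ℝ → ℝ → ℝ≥0∞ := fun r s =>
    {x : ℝ × ℝ | 0 < x.2 ∧ x.2 ≤ x.1}.indicator
      (fun x => E x.1 x.2 * H x.2 ^ q * ENNReal.ofReal (1 + x.1)) (r, s) with hT
  have hTm : Measurable fun x : ℝ × ℝ => T x.1 x.2 := by
    refine Measurable.indicator ?_ hset
    exact (hEm.mul ((hH.comp measurable_snd).pow_const q)).mul (by fun_prop)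
  calc ∫⁻ r in Set.Ioi (0 : ℝ), (∫⁻ s in Set.Ioc 0 r, E r s * H s) ^ q * ENNReal.ofReal (1 + r)
      ≤ ∫⁻ r in Set.Ioi (0 : ℝ), ENNReal.ofReal (1 / β) ^ (q - 1) * ∫⁻ s, T r s := by
        refine lintegral_mono fun r => ?_
        have h1 := rpow_lintegral_exp_neg_le hβ hq hH r
        have h2 : (∫⁻ s in Set.Ioc 0 r, E r s * H s ^ q) * ENNReal.ofReal (1 + r)
            = ∫⁻ s, T r s := by
          rw [← lintegral_mul_const _ (by
            exact (hEm.comp (measurable_const.prodMk measurable_id)).mul (hH.pow_const q)),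
            ← lintegral_indicator measurableSet_Ioc]
          refine lintegral_congr fun s => ?_
          simp only [hT, Set.indicator, Set.mem_Ioc, Set.mem_ofPred_eq]
        calc _ ≤ _ := mul_le_mul_left h1 _
          _ = _ := by rw [mul_assoc, h2]
    _ = ENNReal.ofReal (1 / β) ^ (q - 1) * ∫⁻ r in Set.Ioi (0 : ℝ), ∫⁻ s, T r s := by
        rw [lintegral_const_mul _ hTm.lintegral_prod_right']
    _ ≤ ENNReal.ofReal (1 / β) ^ (q - 1) * ∫⁻ r, ∫⁻ s, T r s := by
        exact mul_le_mul_right (lintegral_mono' Measure.restrict_le_self le_rfl) _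
    _ = ENNReal.ofReal (1 / β) ^ (q - 1) * ∫⁻ s, ∫⁻ r, T r s := by
        rw [lintegral_lintegral_swap hTm.aemeasurable]
    _ ≤ ENNReal.ofReal (1 / β) ^ (q - 1) * ∫⁻ s in Set.Ioi (0 : ℝ),
          H s ^ q * (ENNReal.ofReal (rayConst β) * ENNReal.ofReal (1 + s)) := by
        refine mul_le_mul_right ?_ _
        rw [← lintegral_indicator measurableSet_Ioi]
        refine lintegral_mono fun s => ?_
        by_cases hs : 0 < s
        · rw [Set.indicator_of_mem (Set.mem_Ioi.mpr hs)]
          have h3 : ∀ r, T r s = (Set.Ici s).indicator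
              (fun r => H s ^ q * (E r s * ENNReal.ofReal (1 + r))) r := fun r => by
            simp only [hT, Set.indicator, Set.mem_Ici, Set.mem_ofPred_eq, hs, true_and]
            split_ifs <;> ring
          simp_rw [h3]
          rw [lintegral_indicator measurableSet_Ici, lintegral_const_mul _ (by
            exact (hEm.comp (measurable_id.prodMk measurable_const)).mul (by fun_prop))]
          gcongr
          exact lintegral_exp_neg_mul_sub_Ici_le hβ hs.le
        · have h3 : ∀ r, T r s = 0 := fun r => by simp [hT, hs]
          simp [h3]
    _ = ENNReal.ofReal (1 / β) ^ (q - 1) * ENNReal.ofReal (rayConst β) *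
          ∫⁻ s in Set.Ioi (0 : ℝ), H s ^ q * ENNReal.ofReal (1 + s) := by
        rw [mul_assoc, ← lintegral_const_mul (ENNReal.ofReal (rayConst β)) (by
          exact (hH.pow_const q).mul (by fun_prop))]
        congr 1
        refine lintegral_congr fun s => ?_
        ring
    _ ≤ _ := by
        gcongr
        calc ENNReal.ofReal (1 / β) ^ (q - 1) * ENNReal.ofReal (rayConst β)
            ≤ ENNReal.ofReal (rayConst β) ^ (q - 1) * ENNReal.ofReal (rayConst β) := by
              gcongr
              exact inv_le_rayConst hβ
          _ = ENNReal.ofReal (rayConst β) ^ q := by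
              nth_rw 2 [← ENNReal.rpow_one (ENNReal.ofReal (rayConst β))]
              rw [← ENNReal.rpow_add_of_nonneg _ _ (by linarith) zero_le_one]
              congr 1; ring

/-! ### Integration along rays in the plane -/

/-- The norm of `G` in `L^p((1 + 1 / |z|) dA)`, or its supremum over `z ≠ 0` for `p = ∞`. In polar
coordinates the measure is `(1 + r) dr dθ`; the extra mass near the origin is what makes
integration along rays bounded. -/
noncomputable def rayNorm (p : ℝ≥0∞) (G : ℂ → ℝ≥0∞) : ℝ≥0∞ :=
  if p = ∞ then ⨆ (z : ℂ) (_ : z ≠ 0), G z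
  else (∫⁻ z : ℂ, G z ^ p.toReal * (1 + ‖z‖ₑ⁻¹)) ^ (1 / p.toReal)

theorem ae_ne_zero_complex : ∀ᵐ z : ℂ, z ≠ 0 := by simp [ae_iff]

theorem one_le_toReal {p : ℝ≥0∞} (hp : 1 ≤ p) (h : p ≠ ∞) : 1 ≤ p.toReal := by
  simpa using ENNReal.toReal_mono h hp

theorem rayNorm_mono {p : ℝ≥0∞} {G H : ℂ → ℝ≥0∞} (h : ∀ z, z ≠ 0 → G z ≤ H z) :
    rayNorm p G ≤ rayNorm p H := by
  unfold rayNorm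
  split_ifs with hp
  · exact iSup₂_mono h
  · refine ENNReal.rpow_le_rpow (lintegral_mono_ae ?_) (by positivity)
    filter_upwards [ae_ne_zero_complex] with z hz
    exact mul_le_mul_left (ENNReal.rpow_le_rpow (h z hz) ENNReal.toReal_nonneg) _

theorem rayNorm_const_mul_le {p : ℝ≥0∞} (hp : 1 ≤ p) {c : ℝ≥0∞} (hc : c ≠ ∞) (G : ℂ → ℝ≥0∞) :
    rayNorm p (fun z => c * G z) ≤ c * rayNorm p G := by
  unfold rayNorm
  split_ifs with h
  · refine iSup₂_le fun z hz => mul_le_mul_right ?_ _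
    exact le_iSup₂ (f := fun (z : ℂ) (_ : z ≠ 0) => G z) z hz
  · have h1 := one_le_toReal hp h
    have h0 : 0 < p.toReal := by linarith
    have e : ∀ z, (c * G z) ^ p.toReal * (1 + ‖z‖ₑ⁻¹)
        = c ^ p.toReal * (G z ^ p.toReal * (1 + ‖z‖ₑ⁻¹)) := fun z => by
      rw [ENNReal.mul_rpow_of_nonneg _ _ h0.le, mul_assoc]
    simp_rw [e]
    rw [lintegral_const_mul' _ _ (ENNReal.rpow_ne_top_of_nonneg h0.le hc),
      ENNReal.mul_rpow_of_nonneg _ _ (by positivity), ← ENNReal.rpow_mul,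
      mul_one_div_cancel h0.ne', ENNReal.rpow_one]

theorem measurable_one_add_inv_enorm : Measurable fun z : ℂ => 1 + ‖z‖ₑ⁻¹ := by fun_prop

theorem rayNorm_add_le {p : ℝ≥0∞} (hp : 1 ≤ p) {G H : ℂ → ℝ≥0∞} (hG : Measurable G)
    (hH : Measurable H) :
    rayNorm p (fun z => G z + H z) ≤ rayNorm p G + rayNorm p H := by
  unfold rayNorm
  split_ifs with h
  · refine iSup₂_le fun z hz => add_le_add ?_ ?_
    · exact le_iSup₂ (f := fun (z : ℂ) (_ : z ≠ 0) => G z) z hz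
    · exact le_iSup₂ (f := fun (z : ℂ) (_ : z ≠ 0) => H z) z hz
  · set μ : Measure ℂ := volume.withDensity fun z => 1 + ‖z‖ₑ⁻¹ with hμ
    have e : ∀ F : ℂ → ℝ≥0∞, Measurable F →
        ∫⁻ z : ℂ, F z ^ p.toReal * (1 + ‖z‖ₑ⁻¹) = ∫⁻ z, F z ^ p.toReal ∂μ := fun F hF => by
      rw [hμ, lintegral_withDensity_eq_lintegral_mul _ measurable_one_add_inv_enorm
        (hF.pow_const _)]
      exact lintegral_congr fun z => mul_comm _ _
    rw [e G hG, e H hH, e (fun z => G z + H z) (hG.add hH)]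
    exact ENNReal.lintegral_Lp_add_le hG.aemeasurable hH.aemeasurable (one_le_toReal hp h)

theorem lintegral_polar {F : ℂ → ℝ≥0∞} (hF : Measurable F) :
    ∫⁻ z : ℂ, F z = ∫⁻ θ in Set.Ioo (-Real.pi) Real.pi, ∫⁻ r in Set.Ioi (0 : ℝ),
      ENNReal.ofReal r * F (r * (Real.cos θ + Real.sin θ * Complex.I)) := by
  rw [← Complex.lintegral_comp_polarCoord_symm, polarCoord_target, Measure.volume_eq_prod,
    ← Measure.prod_restrict, lintegral_prod_symm]
  · simp [Complex.polarCoord_symm_apply]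
  · refine Measurable.aemeasurable ?_
    simp only [Complex.polarCoord_symm_apply, smul_eq_mul]
    have : Measurable fun x : ℝ × ℝ =>
        (x.1 : ℂ) * ((Real.cos x.2 : ℂ) + (Real.sin x.2 : ℂ) * Complex.I) := by fun_prop
    exact (by fun_prop : Measurable fun x : ℝ × ℝ => ENNReal.ofReal x.1).mul (hF.comp this)

theorem norm_cos_add_sin_mul_I (θ : ℝ) :
    ‖(Real.cos θ : ℂ) + Real.sin θ * Complex.I‖ = 1 := by
  simp

theorem lintegral_mul_one_add_inv_enorm {F : ℂ → ℝ≥0∞} (hF : Measurable F) :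
    ∫⁻ z : ℂ, F z * (1 + ‖z‖ₑ⁻¹) = ∫⁻ θ in Set.Ioo (-Real.pi) Real.pi, ∫⁻ r in Set.Ioi (0 : ℝ),
      F (r * (Real.cos θ + Real.sin θ * Complex.I)) * ENNReal.ofReal (1 + r) := by
  rw [lintegral_polar (F := fun z => F z * (1 + ‖z‖ₑ⁻¹)) (hF.mul measurable_one_add_inv_enorm)]
  refine lintegral_congr fun θ => setLIntegral_congr_fun measurableSet_Ioi fun r hr => ?_
  have hr0 : (0 : ℝ) < r := hr
  have h1 : ‖(r : ℂ) * (Real.cos θ + Real.sin θ * Complex.I)‖ₑ = ENNReal.ofReal r := by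
    rw [← ofReal_norm, norm_mul, norm_cos_add_sin_mul_I, mul_one, Complex.norm_real,
      Real.norm_of_nonneg hr0.le]
  have h2 : ENNReal.ofReal r ≠ 0 := by simpa using hr0
  simp only [h1]
  rw [mul_left_comm, mul_add (ENNReal.ofReal r), mul_one,
    ENNReal.mul_inv_cancel h2 ENNReal.ofReal_ne_top, add_comm (ENNReal.ofReal r),
    ENNReal.ofReal_add zero_le_one hr0.le, ENNReal.ofReal_one]

/-- For `p = ∞` the kernel `exp (-β (r - s))` on rays has norm at most `1 / β`. -/
theorem rayNorm_top_le {β : ℝ} (hβ : 0 < β) {Φ G : ℂ → ℝ≥0∞}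
    (h : ∀ r : ℝ, 0 < r → ∀ ω : ℂ, ‖ω‖ = 1 → Φ (r * ω) ≤
      ∫⁻ s in Set.Ioc 0 r, ENNReal.ofReal (Real.exp (-(β * (r - s)))) * G (s * ω)) :
    rayNorm ∞ Φ ≤ ENNReal.ofReal (1 / β) * rayNorm ∞ G := by
  simp only [rayNorm, if_true]
  refine iSup₂_le fun z hz => ?_
  have hz0 : 0 < ‖z‖ := norm_pos_iff.mpr hz
  have hz1 : ((‖z‖ : ℝ) : ℂ) ≠ 0 := by exact_mod_cast hz0.ne'
  have h1 := h ‖z‖ hz0 (z / ‖z‖) (by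
    rw [norm_div, Complex.norm_real, norm_norm, div_self hz0.ne'])
  rw [mul_div_cancel₀ _ hz1] at h1
  refine h1.trans ?_
  set M := ⨆ (z : ℂ) (_ : z ≠ 0), G z
  calc _ ≤ ∫⁻ s in Set.Ioc 0 ‖z‖, ENNReal.ofReal (Real.exp (-(β * (‖z‖ - s)))) * M := by
        refine setLIntegral_mono' measurableSet_Ioc fun s hs => ?_
        gcongr
        refine le_iSup₂ (f := fun (z : ℂ) (_ : z ≠ 0) => G z) _ ?_
        have hs0 : (s : ℂ) ≠ 0 := by exact_mod_cast hs.1.ne'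
        exact mul_ne_zero hs0 (div_ne_zero hz hz1)
    _ = (∫⁻ s in Set.Ioc 0 ‖z‖, ENNReal.ofReal (Real.exp (-(β * (‖z‖ - s))))) * M :=
        lintegral_mul_const _ (by fun_prop)
    _ ≤ _ := mul_le_mul_left (lintegral_exp_neg_mul_sub_Ioc_le hβ _) _

/-- The kernel `exp (-β (r - s))` on rays is bounded in `rayNorm p`, with a constant that tends to
`0` as `β → ∞`. -/
theorem rayNorm_le {p : ℝ≥0∞} (hp : 1 ≤ p) {β : ℝ} (hβ : 0 < β) {Φ G : ℂ → ℝ≥0∞}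
    (hG : Measurable G) (hΦ : Measurable Φ)
    (h : ∀ r : ℝ, 0 < r → ∀ ω : ℂ, ‖ω‖ = 1 → Φ (r * ω) ≤
      ∫⁻ s in Set.Ioc 0 r, ENNReal.ofReal (Real.exp (-(β * (r - s)))) * G (s * ω)) :
    rayNorm p Φ ≤ ENNReal.ofReal (rayConst β) * rayNorm p G := by
  by_cases hp' : p = ∞
  · subst hp'
    exact (rayNorm_top_le hβ h).trans
      (mul_le_mul_left (ENNReal.ofReal_le_ofReal (inv_le_rayConst hβ)) _)
  have hq := one_le_toReal hp hp'
  have hq0 : 0 < p.toReal := by linarith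
  simp only [rayNorm, if_neg hp']
  rw [lintegral_mul_one_add_inv_enorm (hΦ.pow_const _),
    lintegral_mul_one_add_inv_enorm (hG.pow_const _)]
  calc _ ≤ (∫⁻ θ in Set.Ioo (-Real.pi) Real.pi, ENNReal.ofReal (rayConst β) ^ p.toReal *
        ∫⁻ s in Set.Ioi (0 : ℝ), G (s * (Real.cos θ + Real.sin θ * Complex.I)) ^ p.toReal
          * ENNReal.ofReal (1 + s)) ^ (1 / p.toReal) := by
        gcongr with θ
        have hGθ : Measurable fun s : ℝ => G (s * (Real.cos θ + Real.sin θ * Complex.I)) :=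
          hG.comp (by fun_prop)
        refine le_trans ?_ (lintegral_rpow_exp_neg_le hβ hq hGθ)
        refine setLIntegral_mono' measurableSet_Ioi fun r hr => ?_
        gcongr
        exact h r hr _ (norm_cos_add_sin_mul_I θ)
    _ = _ := by
        rw [lintegral_const_mul' _ _ (ENNReal.rpow_ne_top_of_nonneg hq0.le ENNReal.ofReal_ne_top),
          ENNReal.mul_rpow_of_nonneg _ _ (by positivity), ← ENNReal.rpow_mul,
          mul_one_div_cancel hq0.ne', ENNReal.rpow_one]

theorem lintegral_closedBall_one_add_inv_enorm_lt_top (R : ℝ) :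
    ∫⁻ z in Metric.closedBall (0 : ℂ) R, (1 + ‖z‖ₑ⁻¹) < ∞ := by
  have h1 : ∫⁻ z in Metric.closedBall (0 : ℂ) R, (1 + ‖z‖ₑ⁻¹)
      = ∫⁻ z, (Metric.closedBall (0 : ℂ) R).indicator (fun _ => 1) z * (1 + ‖z‖ₑ⁻¹) := by
    rw [← lintegral_indicator Metric.isClosed_closedBall.measurableSet]
    refine lintegral_congr fun z => ?_
    by_cases hz : z ∈ Metric.closedBall (0 : ℂ) R <;> simp [hz]
  rw [h1, lintegral_mul_one_add_inv_enorm
    (measurable_const.indicator Metric.isClosed_closedBall.measurableSet)]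
  calc _ ≤ ∫⁻ θ in Set.Ioo (-Real.pi) Real.pi, ENNReal.ofReal (1 + R) * ENNReal.ofReal R := by
        refine lintegral_mono fun θ => ?_
        calc _ ≤ ∫⁻ r in Set.Ioi (0 : ℝ),
              (Set.Iic R).indicator (fun _ => ENNReal.ofReal (1 + R)) r := by
              refine setLIntegral_mono' measurableSet_Ioi fun r hr => ?_
              have hr0 : (0 : ℝ) < r := hr
              have h2 : ‖(r : ℂ) * (Real.cos θ + Real.sin θ * Complex.I)‖ = r := by
                rw [norm_mul, norm_cos_add_sin_mul_I, mul_one, Complex.norm_real,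
                  Real.norm_of_nonneg hr0.le]
              by_cases hrR : r ≤ R
              · rw [Set.indicator_of_mem (by rw [mem_closedBall_zero_iff, h2]; exact hrR),
                  Set.indicator_of_mem (Set.mem_Iic.mpr hrR), one_mul]
                exact ENNReal.ofReal_le_ofReal (by linarith)
              · rw [Set.indicator_of_notMem (by rw [mem_closedBall_zero_iff, h2]; exact hrR),
                  zero_mul]
                exact zero_le
          _ = _ := by
              rw [lintegral_indicator measurableSet_Iic, lintegral_const,
                Measure.restrict_restrict measurableSet_Iic, Measure.restrict_apply_univ,
                Set.inter_comm, Set.Ioi_inter_Iic, Real.volume_Ioc, sub_zero]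
    _ < ∞ := by
        rw [lintegral_const, Measure.restrict_apply_univ, Real.volume_Ioo]
        exact ENNReal.mul_lt_top (ENNReal.mul_lt_top ENNReal.ofReal_lt_top ENNReal.ofReal_lt_top)
          ENNReal.ofReal_lt_top

theorem rayNorm_indicator_closedBall_lt_top {p : ℝ≥0∞} (hp : 1 ≤ p) (R : ℝ) :
    rayNorm p ((Metric.closedBall (0 : ℂ) R).indicator fun _ => 1) < ∞ := by
  unfold rayNorm
  split_ifs with h
  · refine lt_of_le_of_lt (iSup₂_le fun z _ => ?_) ENNReal.one_lt_top
    exact Set.indicator_le_self' (fun _ _ => zero_le) z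
  · have hq := one_le_toReal hp h
    refine ENNReal.rpow_lt_top_of_nonneg (by positivity) (ne_of_lt ?_)
    refine lt_of_le_of_lt (le_of_eq ?_) (lintegral_closedBall_one_add_inv_enorm_lt_top R)
    rw [← lintegral_indicator Metric.isClosed_closedBall.measurableSet]
    refine lintegral_congr fun z => ?_
    by_cases hz : z ∈ Metric.closedBall (0 : ℂ) R
    · simp [hz]
    · simp [hz, ENNReal.zero_rpow_of_pos (by linarith : 0 < p.toReal)]

/-! ### Entire functions: mean values, normal families, primitives -/

theorem enorm_mul_two_pi_le_lintegral_circle {f : ℂ → ℂ} (hf : Differentiable ℂ f) (r : ℝ) :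
    ‖f 0‖ₑ * ENNReal.ofReal (2 * Real.pi) ≤ ∫⁻ θ in Set.Ioo (-Real.pi) Real.pi,
      ‖f (r * (Real.cos θ + Real.sin θ * Complex.I))‖ₑ := by
  have h1 : Real.circleAverage f 0 r = f 0 := hf.diffContOnCl.circleAverage
  rw [Real.circleAverage_eq_integral_add (-Real.pi),
    intervalIntegral.integral_comp_add_right (fun θ => f (circleMap 0 r θ))] at h1
  have h2 : 0 + -Real.pi = -Real.pi := by ring
  have h3 : 2 * Real.pi + -Real.pi = Real.pi := by ring
  rw [h2, h3, intervalIntegral.integral_of_le (by linarith [Real.pi_pos]),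
    integral_Ioc_eq_integral_Ioo] at h1
  have h4 : ∫ θ in Set.Ioo (-Real.pi) Real.pi, f (circleMap 0 r θ) = (2 * Real.pi : ℝ) • f 0 := by
    rw [← h1, smul_smul, mul_inv_cancel₀ (by positivity), one_smul]
  have h5 : ‖f 0‖ₑ * ENNReal.ofReal (2 * Real.pi)
      = ‖∫ θ in Set.Ioo (-Real.pi) Real.pi, f (circleMap 0 r θ)‖ₑ := by
    rw [h4, enorm_smul, Real.enorm_of_nonneg (by positivity), mul_comm]
  rw [h5]
  refine (enorm_integral_le_lintegral_enorm _).trans (le_of_eq ?_)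
  refine lintegral_congr fun θ => ?_
  simp [circleMap, Complex.exp_mul_I]

/-- The sub-mean value property over a disc; the constant is not optimal. -/
theorem enorm_le_lintegral_closedBall {f : ℂ → ℂ} (hf : Differentiable ℂ f) (z : ℂ) :
    ‖f z‖ₑ ≤ ∫⁻ w in Metric.closedBall z 1, ‖f w‖ₑ := by
  wlog hz : z = 0 generalizing f z
  · have h := this (f := fun w => f (z + w)) (by fun_prop) 0 rfl
    rw [add_zero] at h
    refine h.trans (le_of_eq ?_)
    rw [← lintegral_indicator Metric.isClosed_closedBall.measurableSet,
      ← lintegral_indicator Metric.isClosed_closedBall.measurableSet,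
      ← lintegral_add_left_eq_self ((Metric.closedBall z 1).indicator fun w => ‖f w‖ₑ) z]
    refine lintegral_congr fun w => ?_
    simp [Set.indicator, dist_eq_norm]
  subst hz
  have hm : Measurable fun w => (Metric.closedBall (0 : ℂ) 1).indicator (fun w => ‖f w‖ₑ) w :=
    hf.continuous.measurable.enorm.indicator Metric.isClosed_closedBall.measurableSet
  -- in polar coordinates only the annulus `1 / 2 ≤ r ≤ 1` is used
  rw [← lintegral_indicator Metric.isClosed_closedBall.measurableSet, lintegral_polar hm,
    lintegral_lintegral_swap]
  · calc ‖f 0‖ₑ ≤ ∫⁻ _ in Set.Icc (1 / 2 : ℝ) 1, ENNReal.ofReal (1 / 2) *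
          (‖f 0‖ₑ * ENNReal.ofReal (2 * Real.pi)) := by
          rw [lintegral_const, Measure.restrict_apply_univ, Real.volume_Icc, mul_comm,
            mul_left_comm (ENNReal.ofReal (1 / 2)), mul_left_comm,
            ← ENNReal.ofReal_mul (by norm_num), ← ENNReal.ofReal_mul (by norm_num)]
          refine le_mul_of_one_le_right zero_le (ENNReal.one_le_ofReal.mpr ?_)
          linarith [Real.pi_gt_three]
      _ ≤ ∫⁻ r in Set.Icc (1 / 2 : ℝ) 1, ∫⁻ θ in Set.Ioo (-Real.pi) Real.pi, ENNReal.ofReal r *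
          (Metric.closedBall (0 : ℂ) 1).indicator (fun w => ‖f w‖ₑ)
            (r * (Real.cos θ + Real.sin θ * Complex.I)) := by
          refine setLIntegral_mono' measurableSet_Icc fun r hr => ?_
          have hr0 : (0 : ℝ) ≤ r := by linarith [hr.1]
          have h2 : ∀ θ : ℝ, (Metric.closedBall (0 : ℂ) 1).indicator (fun w => ‖f w‖ₑ)
              (r * (Real.cos θ + Real.sin θ * Complex.I))
              = ‖f (r * (Real.cos θ + Real.sin θ * Complex.I))‖ₑ := fun θ => by
            refine Set.indicator_of_mem ?_ _
            rw [mem_closedBall_zero_iff, norm_mul, norm_cos_add_sin_mul_I, mul_one,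
              Complex.norm_real, Real.norm_of_nonneg hr0]
            exact hr.2
          simp_rw [h2]
          rw [lintegral_const_mul' _ _ ENNReal.ofReal_ne_top]
          gcongr
          · exact hr.1
          · exact enorm_mul_two_pi_le_lintegral_circle hf r
      _ ≤ _ := lintegral_mono_set fun r hr => by
          have : (0 : ℝ) < r := by linarith [hr.1]
          exact this
  · have h3 : Measurable fun x : ℝ × ℝ =>
        (x.2 : ℂ) * ((Real.cos x.1 : ℂ) + (Real.sin x.1 : ℂ) * Complex.I) := by fun_prop
    exact ((by fun_prop : Measurable fun x : ℝ × ℝ => ENNReal.ofReal x.2).mul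
      (hm.comp h3)).aemeasurable

/-- Montel's theorem for entire functions. The subsequence is chosen so that all Taylor
coefficients at `0` converge (Tychonoff); Cauchy's estimates then give a dominating series. -/
theorem exists_subseq_tendstoUniformlyOn_closedBall {f : ℕ → ℂ → ℂ}
    (hd : ∀ n, Differentiable ℂ (f n))
    (hb : ∀ R : ℝ, ∃ M : ℝ, ∀ n z, ‖z‖ ≤ R → ‖f n z‖ ≤ M) :
    ∃ g : ℂ → ℂ, Differentiable ℂ g ∧ ∃ φ : ℕ → ℕ, StrictMono φ ∧
      ∀ R : ℝ, TendstoUniformlyOn (fun n => f (φ n)) g atTop (Metric.closedBall 0 R) := by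
  choose M hM using hb
  set a : ℕ → ℕ → ℂ := fun n k => (k.factorial : ℂ)⁻¹ * iteratedDeriv k (f n) 0 with ha
  have hsum : ∀ n z, HasSum (fun k => a n k * z ^ k) (f n z) := fun n z => by
    have := Complex.hasSum_taylorSeries_of_entire (hd n) 0 z
    simp only [sub_zero, smul_eq_mul] at this
    have e : (fun k => a n k * z ^ k)
        = fun k => (k.factorial : ℂ)⁻¹ * (z ^ k * iteratedDeriv k (f n) 0) :=
      funext fun k => by rw [ha]; ring
    rwa [e]
  have hbound : ∀ R : ℝ, 0 < R → ∀ n k, ‖a n k‖ ≤ M R / R ^ k := fun R hR n k => by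
    have h := Complex.norm_iteratedDeriv_le_of_forall_mem_sphere_norm_le k hR
      (hd n).diffContOnCl (c := 0) (C := M R)
      (fun z hz => hM R n z (by rw [mem_sphere_zero_iff_norm] at hz; exact hz.le))
    have hk : (0 : ℝ) < k.factorial := by exact_mod_cast k.factorial_pos
    rw [ha, norm_mul, norm_inv, Complex.norm_natCast, inv_mul_le_iff₀ hk]
    calc _ ≤ _ := h
      _ = _ := by ring
  obtain ⟨b, -, φ, hφ, hlim⟩ :=
    (isCompact_univ_pi fun _ : ℕ => isCompact_closedBall (0 : ℂ) (M 1)).tendsto_subseq (x := a)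
      (fun n k _ => by simpa using hbound 1 one_pos n k)
  have hlimk : ∀ k, Tendsto (fun n => a (φ n) k) atTop (𝓝 (b k)) := fun k =>
    (tendsto_pi_nhds.mp hlim) k
  have hbb : ∀ R : ℝ, 0 < R → ∀ k, ‖b k‖ ≤ M R / R ^ k := fun R hR k =>
    le_of_tendsto (hlimk k).norm (Eventually.of_forall fun n => hbound R hR (φ n) k)
  have hgeo : ∀ R : ℝ, 0 < R → ∀ c : ℂ, ∀ k : ℕ, ‖c‖ ≤ M (2 * R) / (2 * R) ^ k →
      ‖c‖ * R ^ k ≤ M (2 * R) * (1 / 2) ^ k := fun R hR c k hc => by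
    calc ‖c‖ * R ^ k ≤ M (2 * R) / (2 * R) ^ k * R ^ k := by gcongr
      _ = _ := by
          rw [mul_pow, one_div, inv_pow]
          field_simp
  have hgs : ∀ R : ℝ, Summable fun k : ℕ => M (2 * R) * (1 / 2 : ℝ) ^ k := fun R =>
    summable_geometric_two.mul_left _
  have hunif : ∀ R : ℝ, 0 < R → TendstoUniformlyOn (fun n => f (φ n))
      (fun z => ∑' k, b k * z ^ k) atTop (Metric.closedBall 0 R) := fun R hR => by
    have hsb : ∀ z : ℂ, ‖z‖ ≤ R → Summable fun k => b k * z ^ k := fun z hz =>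
      Summable.of_norm_bounded (hgs R) fun k => by
        rw [norm_mul, norm_pow]
        exact le_trans (by gcongr) (hgeo R hR (b k) k (hbb _ (by positivity) k))
    have hdiffb : ∀ n k, ‖a (φ n) k - b k‖ * R ^ k ≤ 2 * (M (2 * R) * (1 / 2) ^ k) := fun n k => by
      have h1 := hgeo R hR _ k (hbound (2 * R) (by positivity) (φ n) k)
      have h2 := hgeo R hR _ k (hbb (2 * R) (by positivity) k)
      calc _ ≤ (‖a (φ n) k‖ + ‖b k‖) * R ^ k := by gcongr; exact norm_sub_le _ _
        _ ≤ _ := by linarith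
    have ht : Tendsto (fun n => ∑' k, ‖a (φ n) k - b k‖ * R ^ k) atTop (𝓝 0) := by
      have h3 := tendsto_tsum_of_dominated_convergence (𝓕 := atTop)
        (f := fun n k => ‖a (φ n) k - b k‖ * R ^ k) (g := fun _ => (0 : ℝ))
        ((hgs R).mul_left 2) (fun k => by
          have h4 := (((hlimk k).sub_const (b k)).norm).mul_const (R ^ k)
          simpa using h4)
        (Eventually.of_forall fun n k => by
          rw [Real.norm_of_nonneg (by positivity)]; exact hdiffb n k)
      simpa using h3
    rw [Metric.tendstoUniformlyOn_iff]
    intro ε hε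
    filter_upwards [ht.eventually (gt_mem_nhds hε)] with n hn z hz
    rw [mem_closedBall_zero_iff] at hz
    rw [dist_comm, dist_eq_norm, ← (hsum (φ n) z).tsum_eq,
      ← (hsum (φ n) z).summable.tsum_sub (hsb z hz)]
    refine lt_of_le_of_lt ?_ hn
    refine tsum_of_norm_bounded (Summable.hasSum ?_) fun k => ?_
    · exact Summable.of_nonneg_of_le (fun k => by positivity) (hdiffb n) ((hgs R).mul_left 2)
    · rw [← sub_mul, norm_mul, norm_pow]
      gcongr
  refine ⟨fun z => ∑' k, b k * z ^ k, fun z => ?_, φ, hφ, fun R => ?_⟩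
  · have h5 := (hunif (‖z‖ + 1) (by positivity)).mono Metric.ball_subset_closedBall
    have h6 := h5.tendstoLocallyUniformlyOn.differentiableOn
      (Eventually.of_forall fun n => (hd (φ n)).differentiableOn) Metric.isOpen_ball
    exact h6.differentiableAt (Metric.isOpen_ball.mem_nhds (by simp))
  · exact (hunif (max R 1) (by positivity)).mono
      (Metric.closedBall_subset_closedBall (le_max_left _ _))

theorem integrationOp_eq_sub {F f : ℂ → ℂ} (hF : ∀ z, HasDerivAt F (f z) z) (hf : Continuous f)
    (z : ℂ) : integrationOp f z = F z - F 0 := by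
  have h1 : ∀ t : ℝ, HasDerivAt (fun t : ℝ => F ((t : ℂ) * z)) (f ((t : ℂ) * z) * z) t := fun t =>
    HasDerivAt.comp_ofReal (e := fun t : ℂ => F (t * z)) (by
      have h := (hF ((t : ℂ) * z)).comp (t : ℂ) ((hasDerivAt_id (t : ℂ)).mul_const z)
      rw [one_mul] at h
      exact h)
  unfold integrationOp
  rw [intervalIntegral.integral_eq_sub_of_hasDerivAt (fun t _ => h1 t)
    (Continuous.intervalIntegrable (by fun_prop) _ _)]
  simp

theorem hasDerivAt_integrationOp {f : ℂ → ℂ} (hf : Differentiable ℂ f) (z : ℂ) :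
    HasDerivAt (integrationOp f) (f z) z := by
  obtain ⟨F, hF⟩ := hf.isExactOn_univ
  have h : integrationOp f = fun z => F z - F 0 :=
    funext fun z => integrationOp_eq_sub (fun w => hF w trivial) hf.continuous z
  rw [h]
  exact (hF z trivial).sub_const _

theorem differentiable_integrationOp {f : ℂ → ℂ} (hf : Differentiable ℂ f) :
    Differentiable ℂ (integrationOp f) :=
  fun z => (hasDerivAt_integrationOp hf z).differentiableAt

theorem enorm_integrationOp_le (f : ℂ → ℂ) {r : ℝ} (hr : 0 < r) {ω : ℂ} (hω : ‖ω‖ = 1) :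
    ‖integrationOp f (r * ω)‖ₑ ≤ ∫⁻ s in Set.Ioc 0 r, ‖f (s * ω)‖ₑ := by
  have h1 : integrationOp f (r * ω) = (∫ s in (0 : ℝ)..r, f (s * ω)) * ω := by
    have h2 := intervalIntegral.smul_integral_comp_mul_right (a := 0) (b := 1)
      (fun s : ℝ => f (s * ω)) r
    rw [zero_mul, one_mul] at h2
    rw [← h2, integrationOp, intervalIntegral.integral_mul_const, Complex.real_smul]
    simp only [Complex.ofReal_mul, mul_assoc]
    ring
  rw [h1, enorm_mul, intervalIntegral.integral_of_le hr.le]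
  have h3 : ‖ω‖ₑ = 1 := by rw [← ofReal_norm, hω, ENNReal.ofReal_one]
  rw [h3, mul_one]
  exact enorm_integral_le_lintegral_enorm _

/-! ### Pointwise bounds in the generalized Fock space -/

theorem enorm_fockWeighted (α m : ℝ) (f : ℂ → ℂ) (z : ℂ) :
    ‖fockWeighted α m f z‖ₑ = ENNReal.ofReal (Real.exp (-(α * ‖z‖ ^ m))) * ‖f z‖ₑ := by
  rw [← ofReal_norm, norm_fockWeighted, ENNReal.ofReal_mul (Real.exp_pos _).le, ofReal_norm]

theorem enorm_eq_exp_mul_enorm_fockWeighted (α m : ℝ) (f : ℂ → ℂ) (z : ℂ) :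
    ‖f z‖ₑ = ENNReal.ofReal (Real.exp (α * ‖z‖ ^ m)) * ‖fockWeighted α m f z‖ₑ := by
  rw [enorm_fockWeighted, ← mul_assoc, ← ENNReal.ofReal_mul (Real.exp_pos _).le, ← Real.exp_add]
  simp

/-- Point evaluations are bounded on the Fock space, with a bound that for `m = 1` is
`exp (α |z|)` up to a constant. -/
theorem enorm_le_mul_fockENorm {p : ℝ≥0∞} (hp : 1 ≤ p) {α m : ℝ} (hα : 0 ≤ α) (hm : 0 ≤ m)
    {f : ℂ → ℂ} (hf : Differentiable ℂ f) (z : ℂ) :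
    ‖f z‖ₑ ≤ ENNReal.ofReal (Real.exp (α * (‖z‖ + 1) ^ m)) *
      (fockENorm p α m f * (NNReal.pi : ℝ≥0∞) ^ (1 - 1 / p.toReal)) := by
  set μ : Measure ℂ := volume.restrict (Metric.closedBall z 1) with hμ
  have hvol : μ Set.univ = NNReal.pi := by
    rw [hμ, Measure.restrict_apply_univ, Complex.volume_closedBall]
    simp
  have hmeas := aestronglyMeasurable_fockWeighted α m hf.continuous
  calc ‖f z‖ₑ ≤ ∫⁻ w in Metric.closedBall z 1, ‖f w‖ₑ := enorm_le_lintegral_closedBall hf z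
    _ ≤ ∫⁻ w in Metric.closedBall z 1, ENNReal.ofReal (Real.exp (α * (‖z‖ + 1) ^ m)) *
          ‖fockWeighted α m f w‖ₑ := by
        refine setLIntegral_mono' Metric.isClosed_closedBall.measurableSet fun w hw => ?_
        rw [enorm_eq_exp_mul_enorm_fockWeighted α m f w]
        have h1 : ‖w‖ ≤ ‖z‖ + 1 := by
          rw [mem_closedBall_iff_norm] at hw
          linarith [norm_le_norm_add_norm_sub' w z]
        gcongr
    _ = ENNReal.ofReal (Real.exp (α * (‖z‖ + 1) ^ m)) * eLpNorm (fockWeighted α m f) 1 μ := by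
        rw [lintegral_const_mul' _ _ ENNReal.ofReal_ne_top, eLpNorm_one_eq_lintegral_enorm]
    _ ≤ _ := by
        gcongr
        rw [fockENorm_eq_eLpNorm (zero_lt_one.trans_le hp).ne' α m hf.continuous]
        refine (eLpNorm_le_eLpNorm_mul_rpow_measure_univ hp hmeas.restrict).trans ?_
        rw [hvol, ENNReal.toReal_one, div_one]
        exact mul_le_mul_left (eLpNorm_mono_measure _ Measure.restrict_le_self) _

theorem fockENorm_le_rayNorm {p : ℝ≥0∞} (α m : ℝ) (f : ℂ → ℂ) :
    fockENorm p α m f ≤ rayNorm p fun z => ‖fockWeighted α m f z‖ₑ := by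
  unfold fockENorm rayNorm
  split_ifs with h
  · refine iSup₂_mono fun z _ => ?_
    beta_reduce
    rw [← ofReal_norm, norm_fockWeighted]
  · refine ENNReal.rpow_le_rpow (lintegral_mono fun z => ?_) (by positivity)
    beta_reduce
    rw [← ofReal_norm (fockWeighted α m f z), norm_fockWeighted,
      ENNReal.ofReal_rpow_of_nonneg (by positivity) ENNReal.toReal_nonneg,
      Real.mul_rpow (by positivity) (norm_nonneg _), ← Real.exp_mul, mul_comm (Real.exp _)]
    have e : -(α * ‖z‖ ^ m) * p.toReal = -(p.toReal * α * ‖z‖ ^ m) := by ring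
    rw [e]
    exact le_mul_of_one_le_right zero_le le_self_add

theorem measurable_enorm_fockWeighted (α m : ℝ) {f : ℂ → ℂ} (hf : Continuous f) :
    Measurable fun z => ‖fockWeighted α m f z‖ₑ := by
  unfold fockWeighted
  have := hf.measurable
  fun_prop

/-- For `p = ∞` the Fock norm is the `rayNorm`. -/
theorem rayNorm_top_fockWeighted (α m : ℝ) (f : ℂ → ℂ) :
    rayNorm ∞ (fun z => ‖fockWeighted α m f z‖ₑ) = fockENorm ∞ α m f := by
  simp only [rayNorm, fockENorm, if_true, ← ofReal_norm, norm_fockWeighted]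

/-- On entire functions the extra mass near the origin in `rayNorm` is harmless, since point
evaluations are bounded. -/
theorem exists_rayNorm_le_mul_fockENorm {p : ℝ≥0∞} (hp : 1 ≤ p) {α m : ℝ} (hα : 0 ≤ α)
    (hm : 0 ≤ m) :
    ∃ C : ℝ≥0∞, C ≠ ∞ ∧ ∀ f : ℂ → ℂ, Differentiable ℂ f →
      rayNorm p (fun z => ‖fockWeighted α m f z‖ₑ) ≤ C * fockENorm p α m f := by
  set B : ℂ → ℝ≥0∞ := (Metric.closedBall (0 : ℂ) 1).indicator fun _ => 1 with hB
  have hBm : Measurable B := measurable_const.indicator Metric.isClosed_closedBall.measurableSet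
  have hBfin := rayNorm_indicator_closedBall_lt_top hp 1
  set c : ℝ≥0∞ := ENNReal.ofReal (Real.exp (α * (1 + 1) ^ m)) *
    (NNReal.pi : ℝ≥0∞) ^ (1 - 1 / p.toReal) with hc
  have hc' : c ≠ ∞ := by
    refine ENNReal.mul_ne_top ENNReal.ofReal_ne_top ?_
    exact ENNReal.rpow_ne_top_of_ne_zero (by simpa using NNReal.pi_pos.ne') ENNReal.coe_ne_top
  refine ⟨c * rayNorm p B + 2, by finiteness, fun f hf => ?_⟩
  by_cases hfin : fockENorm p α m f = ∞
  · rw [hfin, ENNReal.mul_top (by simp)]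
    exact le_top
  have hm0 := measurable_enorm_fockWeighted α m hf.continuous
  set G : ℂ → ℝ≥0∞ := fun z => ‖fockWeighted α m f z‖ₑ with hG
  set G1 : ℂ → ℝ≥0∞ := (Metric.closedBall (0 : ℂ) 1)ᶜ.indicator G with hG1
  have hG1m : Measurable G1 := hm0.indicator Metric.isClosed_closedBall.measurableSet.compl
  have hG1n : rayNorm p G1 ≤ 2 * fockENorm p α m f := by
    by_cases h : p = ∞
    · subst h
      rw [← rayNorm_top_fockWeighted]
      refine (rayNorm_mono fun z _ => Set.indicator_le_self _ _ z).trans ?_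
      exact le_mul_of_one_le_left zero_le one_le_two
    have hq := one_le_toReal hp h
    have hq0 : 0 < p.toReal := by linarith
    rw [fockENorm_eq_eLpNorm (zero_lt_one.trans_le hp).ne' α m hf.continuous,
      eLpNorm_eq_lintegral_rpow_enorm_toReal (zero_lt_one.trans_le hp).ne' h]
    simp only [rayNorm, if_neg h]
    calc _ ≤ (∫⁻ z, 2 * G z ^ p.toReal) ^ (1 / p.toReal) := by
          refine ENNReal.rpow_le_rpow (lintegral_mono fun z => ?_) (by positivity)
          beta_reduce
          by_cases hz : z ∈ Metric.closedBall (0 : ℂ) 1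
          · rw [hG1, Set.indicator_of_notMem (by simpa using hz), ENNReal.zero_rpow_of_pos hq0,
              zero_mul]
            exact zero_le
          · rw [hG1, Set.indicator_of_mem hz, mul_comm]
            gcongr
            rw [← one_add_one_eq_two]
            gcongr
            rw [ENNReal.inv_le_one, ← ofReal_norm, ENNReal.one_le_ofReal]
            rw [mem_closedBall_zero_iff, not_le] at hz
            exact hz.le
      _ = 2 ^ (1 / p.toReal) * (∫⁻ z, G z ^ p.toReal) ^ (1 / p.toReal) := by
          rw [lintegral_const_mul' _ _ (by simp), ENNReal.mul_rpow_of_nonneg _ _ (by positivity)]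
      _ ≤ 2 * (∫⁻ z, G z ^ p.toReal) ^ (1 / p.toReal) := by
          gcongr
          nth_rw 2 [← ENNReal.rpow_one 2]
          exact ENNReal.rpow_le_rpow_of_exponent_le one_le_two
            ((div_le_one hq0).mpr hq)
  have hfin2 : c * fockENorm p α m f ≠ ∞ := ENNReal.mul_ne_top hc' hfin
  calc rayNorm p G ≤ rayNorm p fun z => (c * fockENorm p α m f) * B z + G1 z := by
        refine rayNorm_mono fun z _ => ?_
        by_cases hz : z ∈ Metric.closedBall (0 : ℂ) 1
        · rw [hB, Set.indicator_of_mem hz, mul_one]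
          refine le_add_right ?_
          have hz1 : ‖z‖ ≤ 1 := by simpa using hz
          calc G z ≤ ‖f z‖ₑ := by
                rw [hG]
                simp only [enorm_fockWeighted]
                refine mul_le_of_le_one_left zero_le (ENNReal.ofReal_le_one.mpr ?_)
                rw [Real.exp_le_one_iff]
                have : 0 ≤ α * ‖z‖ ^ m := by positivity
                linarith
            _ ≤ _ := enorm_le_mul_fockENorm hp hα hm hf z
            _ ≤ ENNReal.ofReal (Real.exp (α * (1 + 1) ^ m)) *
                (fockENorm p α m f * (NNReal.pi : ℝ≥0∞) ^ (1 - 1 / p.toReal)) := by gcongr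
            _ = _ := by rw [hc]; ring
        · rw [hG1, Set.indicator_of_mem (by simpa using hz)]
          exact le_add_self
    _ ≤ rayNorm p (fun z => (c * fockENorm p α m f) * B z) + rayNorm p G1 :=
        rayNorm_add_le hp (hBm.const_mul _) hG1m
    _ ≤ (c * fockENorm p α m f) * rayNorm p B + 2 * fockENorm p α m f := by
        gcongr
        exact rayNorm_const_mul_le hp hfin2 B
    _ = _ := by ring

/-! ### The weighted estimate for the integration operator -/

/-- The modulus of `f` with the weight `exp (-(α r ^ m + β min r R))`, which is equivalent to the
Fock weight. If `β ≤ α r ^ (m - 1)` for `r ≥ R`, its exponent increases along rays with slope at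
least `β`, also near the origin. -/
noncomputable def tiltedModulus (α m β R : ℝ) (f : ℂ → ℂ) (z : ℂ) : ℝ≥0∞ :=
  ENNReal.ofReal (Real.exp (-(α * ‖z‖ ^ m + β * min ‖z‖ R))) * ‖f z‖ₑ

theorem measurable_tiltedModulus (α m β R : ℝ) {f : ℂ → ℂ} (hf : Continuous f) :
    Measurable (tiltedModulus α m β R f) := by
  unfold tiltedModulus
  have := hf.measurable
  fun_prop

theorem mul_sub_le_tilt_sub {α m β R r s : ℝ} (hα : 0 ≤ α) (hm : 1 ≤ m)
    (hβR : ∀ r, R ≤ r → 0 < r → β ≤ α * r ^ (m - 1)) (hs : 0 < s) (hsr : s ≤ r) (hβ : 0 ≤ β) :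
    β * (r - s) ≤ (α * r ^ m + β * min r R) - (α * s ^ m + β * min s R) := by
  have hr : 0 < r := hs.trans_le hsr
  rcases le_total r R with h | h
  · rw [min_eq_left h, min_eq_left (hsr.trans h)]
    have : s ^ m ≤ r ^ m := Real.rpow_le_rpow hs.le hsr (by linarith)
    nlinarith
  · have h1 : r ^ m = r * r ^ (m - 1) := by
      rw [mul_comm, ← Real.rpow_add_one hr.ne', sub_add_cancel]
    have h2 : s ^ m = s * s ^ (m - 1) := by
      rw [mul_comm, ← Real.rpow_add_one hs.ne', sub_add_cancel]
    have h3 : s ^ (m - 1) ≤ r ^ (m - 1) := Real.rpow_le_rpow hs.le hsr (by linarith)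
    have h4 : min s R ≤ min r R := min_le_min_right R hsr
    have h5 := hβR r h hr
    have h6 : β * min s R ≤ β * min r R := by gcongr
    have h7 : β * (r - s) ≤ α * r ^ (m - 1) * (r - s) := by
      have : 0 ≤ r - s := by linarith
      gcongr
    have h8 : α * (s * s ^ (m - 1)) ≤ α * (s * r ^ (m - 1)) := by gcongr
    rw [h1, h2]
    linarith

theorem tiltedModulus_integrationOp_le {α m β R : ℝ} (hα : 0 ≤ α) (hm : 1 ≤ m) (hβ : 0 ≤ β)
    (hβR : ∀ r, R ≤ r → 0 < r → β ≤ α * r ^ (m - 1)) (f : ℂ → ℂ) {r : ℝ} (hr : 0 < r) {ω : ℂ}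
    (hω : ‖ω‖ = 1) :
    tiltedModulus α m β R (integrationOp f) (r * ω) ≤ ∫⁻ s in Set.Ioc 0 r,
      ENNReal.ofReal (Real.exp (-(β * (r - s)))) * tiltedModulus α m β R f (s * ω) := by
  have hn : ∀ s : ℝ, 0 < s → ‖(s : ℂ) * ω‖ = s := fun s hs => by
    rw [norm_mul, hω, mul_one, Complex.norm_real, Real.norm_of_nonneg hs.le]
  calc _ ≤ ENNReal.ofReal (Real.exp (-(α * r ^ m + β * min r R))) *
        ∫⁻ s in Set.Ioc 0 r, ‖f (s * ω)‖ₑ := by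
        unfold tiltedModulus
        rw [hn r hr]
        gcongr
        exact enorm_integrationOp_le f hr hω
    _ = ∫⁻ s in Set.Ioc 0 r, ENNReal.ofReal (Real.exp (-(α * r ^ m + β * min r R))) *
          ‖f (s * ω)‖ₑ := (lintegral_const_mul' _ _ ENNReal.ofReal_ne_top).symm
    _ ≤ _ := by
        refine setLIntegral_mono' measurableSet_Ioc fun s hs => ?_
        unfold tiltedModulus
        rw [hn s hs.1, ← mul_assoc, ← ENNReal.ofReal_mul (Real.exp_pos _).le, ← Real.exp_add]
        gcongr
        linarith [mul_sub_le_tilt_sub hα hm hβR hs.1 hs.2 hβ]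

theorem differentiable_iterate_integrationOp {f : ℂ → ℂ} (hf : Differentiable ℂ f) (n : ℕ) :
    Differentiable ℂ (integrationOp^[n] f) := by
  induction n with
  | zero => exact hf
  | succ n ih => rw [Function.iterate_succ_apply']; exact differentiable_integrationOp ih

theorem rayNorm_tiltedModulus_iterate_le {p : ℝ≥0∞} (hp : 1 ≤ p) {α m β R : ℝ} (hα : 0 ≤ α)
    (hm : 1 ≤ m) (hβ : 0 < β) (hβR : ∀ r, R ≤ r → 0 < r → β ≤ α * r ^ (m - 1)) {f : ℂ → ℂ}
    (hf : Differentiable ℂ f) (n : ℕ) :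
    rayNorm p (tiltedModulus α m β R (integrationOp^[n] f))
      ≤ ENNReal.ofReal (rayConst β) ^ n * rayNorm p (tiltedModulus α m β R f) := by
  induction n with
  | zero => simp
  | succ n ih =>
    have hd := differentiable_iterate_integrationOp hf n
    rw [Function.iterate_succ_apply', pow_succ', mul_assoc]
    refine (rayNorm_le hp hβ (measurable_tiltedModulus α m β R hd.continuous)
      (measurable_tiltedModulus α m β R (differentiable_integrationOp hd).continuous)
      fun r hr ω hω => tiltedModulus_integrationOp_le hα hm hβ.le hβR _ hr hω).trans ?_
    gcongr

theorem tiltedModulus_le_enorm_fockWeighted {α m β R : ℝ} (hβ : 0 ≤ β) (hR : 0 ≤ R) (f : ℂ → ℂ)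
    (z : ℂ) : tiltedModulus α m β R f z ≤ ‖fockWeighted α m f z‖ₑ := by
  rw [enorm_fockWeighted, tiltedModulus]
  gcongr
  have : 0 ≤ β * min ‖z‖ R := by positivity
  linarith

theorem enorm_fockWeighted_le_tiltedModulus {α m β R : ℝ} (hβ : 0 ≤ β) (f : ℂ → ℂ) (z : ℂ) :
    ‖fockWeighted α m f z‖ₑ ≤ ENNReal.ofReal (Real.exp (β * R)) * tiltedModulus α m β R f z := by
  rw [enorm_fockWeighted, tiltedModulus, ← mul_assoc, ← ENNReal.ofReal_mul (Real.exp_pos _).le,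
    ← Real.exp_add]
  gcongr
  have : β * min ‖z‖ R ≤ β * R := by gcongr; exact min_le_right _ _
  linarith

/-- The powers of the integration operator decay like `rayConst β ^ n`. -/
theorem exists_fockENorm_iterate_le {p : ℝ≥0∞} (hp : 1 ≤ p) {α m β R : ℝ} (hα : 0 ≤ α)
    (hm : 1 ≤ m) (hβ : 0 < β) (hR : 0 ≤ R)
    (hβR : ∀ r, R ≤ r → 0 < r → β ≤ α * r ^ (m - 1)) :
    ∃ C : ℝ≥0∞, C ≠ ∞ ∧ ∀ f : ℂ → ℂ, Differentiable ℂ f → ∀ n : ℕ,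
      fockENorm p α m (integrationOp^[n] f)
        ≤ C * ENNReal.ofReal (rayConst β) ^ n * fockENorm p α m f := by
  obtain ⟨C, hC, h⟩ := exists_rayNorm_le_mul_fockENorm hp hα (zero_le_one.trans hm)
  refine ⟨ENNReal.ofReal (Real.exp (β * R)) * C, by finiteness, fun f hf n => ?_⟩
  calc fockENorm p α m (integrationOp^[n] f)
      ≤ rayNorm p fun z => ENNReal.ofReal (Real.exp (β * R)) *
          tiltedModulus α m β R (integrationOp^[n] f) z :=
        (fockENorm_le_rayNorm α m _).trans
          (rayNorm_mono fun z _ => enorm_fockWeighted_le_tiltedModulus hβ.le _ z)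
    _ ≤ ENNReal.ofReal (Real.exp (β * R)) *
          rayNorm p (tiltedModulus α m β R (integrationOp^[n] f)) :=
        rayNorm_const_mul_le hp ENNReal.ofReal_ne_top _
    _ ≤ ENNReal.ofReal (Real.exp (β * R)) * (ENNReal.ofReal (rayConst β) ^ n *
          (C * fockENorm p α m f)) := by
        gcongr
        refine (rayNorm_tiltedModulus_iterate_le hp hα hm hβ hβR hf n).trans ?_
        gcongr
        exact (rayNorm_mono fun z _ => tiltedModulus_le_enorm_fockWeighted hβ.le hR f z).trans
          (h f hf)
    _ = _ := by ring

/-- The estimate behind compactness: the part of `f` outside the disc of radius `R` contributes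
little to `integrationOp f`, and the rest is controlled by the supremum of `|f|` on the disc. -/
theorem fockENorm_integrationOp_le {p : ℝ≥0∞} (hp : 1 ≤ p) {α m β R : ℝ} (hα : 0 ≤ α)
    (hm : 1 ≤ m) (hβ : 0 < β) (hβR : ∀ r, R ≤ r → 0 < r → β ≤ α * r ^ (m - 1)) {f : ℂ → ℂ}
    (hf : Differentiable ℂ f) {M : ℝ≥0∞} (hM : M ≠ ∞) (hfM : ∀ z, ‖z‖ ≤ R → ‖f z‖ₑ ≤ M) :
    fockENorm p α m (integrationOp f) ≤ ENNReal.ofReal (rayConst β) *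
      (rayNorm p (fun z => ‖fockWeighted α m f z‖ₑ) + ENNReal.ofReal (Real.exp (β * R)) * M *
        rayNorm p ((Metric.closedBall (0 : ℂ) R).indicator fun _ => 1)) := by
  set e : ℝ≥0∞ := ENNReal.ofReal (Real.exp (β * R)) with he
  have heM : e * M ≠ ∞ := ENNReal.mul_ne_top ENNReal.ofReal_ne_top hM
  have hJ := (differentiable_integrationOp hf).continuous
  calc fockENorm p α m (integrationOp f)
      ≤ rayNorm p fun z => e * tiltedModulus α m β R (integrationOp f) z :=
        (fockENorm_le_rayNorm α m _).trans
          (rayNorm_mono fun z _ => enorm_fockWeighted_le_tiltedModulus hβ.le _ z)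
    _ ≤ ENNReal.ofReal (rayConst β) * rayNorm p fun z => e * tiltedModulus α m β R f z := by
        refine rayNorm_le hp hβ ((measurable_tiltedModulus α m β R hf.continuous).const_mul e)
          ((measurable_tiltedModulus α m β R hJ).const_mul e) fun r hr ω hω => ?_
        refine (mul_le_mul_right
          (tiltedModulus_integrationOp_le hα hm hβ.le hβR f hr hω) e).trans (le_of_eq ?_)
        rw [← lintegral_const_mul' _ _ ENNReal.ofReal_ne_top]
        exact lintegral_congr fun s => by ring
    _ ≤ _ := by
        refine mul_le_mul_right ?_ _
        calc _ ≤ rayNorm p fun z => ‖fockWeighted α m f z‖ₑ +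
              e * M * (Metric.closedBall (0 : ℂ) R).indicator (fun _ => 1) z := by
              refine rayNorm_mono fun z _ => ?_
              by_cases hz : ‖z‖ ≤ R
              · rw [Set.indicator_of_mem (by simpa using hz), mul_one]
                refine le_add_left (mul_le_mul_right ?_ _)
                refine (mul_le_of_le_one_left zero_le (ENNReal.ofReal_le_one.mpr ?_)).trans
                  (hfM z hz)
                rw [Real.exp_le_one_iff, min_eq_left hz]
                have : 0 ≤ α * ‖z‖ ^ m + β * ‖z‖ := by positivity
                linarith
              · refine le_add_right (le_of_eq ?_)
                rw [enorm_fockWeighted, tiltedModulus, ← mul_assoc, he,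
                  ← ENNReal.ofReal_mul (Real.exp_pos _).le, ← Real.exp_add,
                  min_eq_right (not_le.mp hz).le]
                congr 3
                ring
          _ ≤ _ := by
              refine (rayNorm_add_le hp (measurable_enorm_fockWeighted α m hf.continuous)
                ((measurable_const.indicator
                  Metric.isClosed_closedBall.measurableSet).const_mul _)).trans ?_
              gcongr
              exact rayNorm_const_mul_le hp heM _

/-! ### Powers and means of a bounded operator -/

section Operators

variable {X : Type*} [NormedAddCommGroup X] [NormedSpace ℂ X]

theorem isPowerBounded_of_summable {T : X →L[ℂ] X} (h : Summable fun n => ‖T ^ n‖) :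
    IsPowerBounded T := by
  refine ⟨∑' n, ‖T ^ n‖ + 1, by positivity, fun n => ?_⟩
  linarith [h.le_tsum n fun _ _ => norm_nonneg _]

theorem isUniformlyMeanErgodic_of_summable {T : X →L[ℂ] X} (h : Summable fun n => ‖T ^ n‖) :
    IsUniformlyMeanErgodic T := by
  refine ⟨0, squeeze_zero_norm (a := fun n : ℕ => (n : ℝ)⁻¹ * ∑' n, ‖T ^ n‖) (fun n => ?_) ?_⟩
  · rw [norm_smul, norm_inv, Complex.norm_natCast]
    gcongr
    exact (norm_sum_le _ _).trans (h.sum_le_tsum _ fun _ _ => norm_nonneg _)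
  · simpa using (tendsto_inv_atTop_nhds_zero_nat (𝕜 := ℝ)).mul_const (∑' n, ‖T ^ n‖)

theorem summable_norm_pow_of_le_geometric {T : X →L[ℂ] X} {C ε : ℝ} (hε : 0 ≤ ε) (hε1 : ε < 1)
    (h : ∀ n, ‖T ^ n‖ ≤ C * ε ^ n) : Summable fun n => ‖T ^ n‖ :=
  Summable.of_nonneg_of_le (fun _ => norm_nonneg _) h
    ((summable_geometric_of_lt_one hε hε1).mul_left C)

theorem isQuasiNilpotent_of_forall_le_geometric {T : X →L[ℂ] X}
    (h : ∀ ε : ℝ, 0 < ε → ∃ C : ℝ, ∀ n, ‖T ^ n‖ ≤ C * ε ^ n) : IsQuasiNilpotent T := by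
  refine (tendsto_order.mpr ⟨fun a ha => Eventually.of_forall fun n =>
    ha.trans_le (by positivity), fun ε hε => ?_⟩)
  obtain ⟨C, hC⟩ := h (ε / 2) (by positivity)
  set D := max C 1 with hD
  have hD0 : 0 < D := lt_of_lt_of_le one_pos (le_max_right _ _)
  have hlim : Tendsto (fun n : ℕ => D ^ (1 / (n : ℝ)) * (ε / 2)) atTop
      (𝓝 (D ^ (0 : ℝ) * (ε / 2))) :=
    (Tendsto.rpow tendsto_const_nhds tendsto_one_div_atTop_nhds_zero_nat
      (Or.inl hD0.ne')).mul_const _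
  have hlt : D ^ (0 : ℝ) * (ε / 2) < ε := by rw [Real.rpow_zero]; linarith
  filter_upwards [hlim.eventually (gt_mem_nhds hlt), eventually_gt_atTop 0] with n hn hn0
  refine lt_of_le_of_lt ?_ hn
  have hn1 : (n : ℝ) ≠ 0 := by exact_mod_cast hn0.ne'
  calc ‖T ^ n‖ ^ (1 / (n : ℝ)) ≤ (D * (ε / 2) ^ n) ^ (1 / (n : ℝ)) := by
        gcongr
        exact (hC n).trans (by gcongr; exact le_max_left _ _)
    _ = _ := by
        rw [Real.mul_rpow hD0.le (by positivity), one_div,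
          Real.pow_rpow_inv_natCast (by positivity) hn0.ne']

/-- If the means of `T` converge in norm, then `‖T ^ n‖` grows at most linearly, because
`T ^ n` is a difference of consecutive partial sums. -/
theorem IsUniformlyMeanErgodic.norm_pow_le {T : X →L[ℂ] X} (h : IsUniformlyMeanErgodic T) :
    ∃ C : ℝ, ∀ n : ℕ, ‖T ^ n‖ ≤ C * (n + 1) := by
  obtain ⟨P, hP⟩ := h
  obtain ⟨B, hB⟩ := hP.norm.bddAbove_range
  have hB' : ∀ n : ℕ, ‖∑ k ∈ Finset.Icc 1 n, T ^ k‖ ≤ B * n := fun n => by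
    rcases Nat.eq_zero_or_pos n with rfl | hn
    · simp
    have h1 : ‖((n : ℂ)⁻¹) • ∑ k ∈ Finset.Icc 1 n, T ^ k‖ ≤ B := hB ⟨n, rfl⟩
    have hn' : (0 : ℝ) < n := by exact_mod_cast hn
    rwa [norm_smul, norm_inv, Complex.norm_natCast, inv_mul_le_iff₀ hn', mul_comm] at h1
  have hB0 : 0 ≤ B := (norm_nonneg _).trans (hB ⟨0, rfl⟩)
  refine ⟨max (2 * B) ‖(1 : X →L[ℂ] X)‖, fun n => ?_⟩
  cases n with
  | zero => simp
  | succ n =>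
    have h2 : T ^ (n + 1) = ∑ k ∈ Finset.Icc 1 (n + 1), T ^ k - ∑ k ∈ Finset.Icc 1 n, T ^ k := by
      rw [Finset.sum_Icc_succ_top (by omega), add_sub_cancel_left]
    calc ‖T ^ (n + 1)‖ ≤ B * (n + 1 : ℕ) + B * n := by
          rw [h2]
          exact (norm_sub_le _ _).trans (add_le_add (hB' _) (hB' _))
      _ ≤ 2 * B * ((n + 1 : ℕ) + 1) := by push_cast; nlinarith
      _ ≤ _ := by gcongr; exact le_max_left _ _

/-- If the means converge in norm and `1` is not an eigenvalue, then the limit is `0`, so some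
mean `M` has norm at most `1 / 2`; as `1 - M` factors through `1 - T`, the latter is bounded
below. -/
theorem IsUniformlyMeanErgodic.exists_norm_le {T : X →L[ℂ] X} (h : IsUniformlyMeanErgodic T)
    (hker : ∀ x, T x = x → x = 0) : ∃ C : ℝ, 0 ≤ C ∧ ∀ x, ‖x‖ ≤ C * ‖x - T x‖ := by
  obtain ⟨P, hP⟩ := h
  set S : ℕ → X →L[ℂ] X := fun n => ∑ k ∈ Finset.Icc 1 n, T ^ k with hS
  have hSsucc : ∀ n, S (n + 1) = S n + T ^ (n + 1) := fun n => by
    simp only [hS]; rw [Finset.sum_Icc_succ_top (by omega)]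
  have hTS : ∀ n, T * S n = S (n + 1) - T := fun n => by
    induction n with
    | zero => simp [hS]
    | succ n ih => rw [hSsucc (n + 1), hSsucc n, mul_add, ih, hSsucc n, ← pow_succ']; abel
  have hinv : Tendsto (fun n : ℕ => ((n : ℂ)⁻¹)) atTop (𝓝 0) := tendsto_inv_atTop_nhds_zero_nat
  have hTP : T * P = P := by
    have h1 : Tendsto (fun n : ℕ => T * (((n : ℂ)⁻¹) • S n)) atTop (𝓝 (T * P)) :=
      hP.const_mul T
    have h2 : Tendsto (fun n : ℕ => (1 + (n : ℂ)⁻¹) • (((n + 1 : ℕ) : ℂ)⁻¹ • S (n + 1))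
        - (n : ℂ)⁻¹ • T) atTop (𝓝 ((1 + (0 : ℂ)) • P - (0 : ℂ) • T)) :=
      ((hinv.const_add 1).smul (hP.comp (tendsto_add_atTop_nat 1))).sub (hinv.smul_const T)
    rw [add_zero, one_smul, zero_smul, sub_zero] at h2
    refine tendsto_nhds_unique (h1.congr' ?_) h2
    filter_upwards [eventually_gt_atTop 0] with n hn
    have hn0 : (n : ℂ) ≠ 0 := by exact_mod_cast hn.ne'
    have hn1 : ((n + 1 : ℕ) : ℂ) ≠ 0 := by exact_mod_cast n.succ_ne_zero
    have h3 : (1 + (n : ℂ)⁻¹) * ((n + 1 : ℕ) : ℂ)⁻¹ = (n : ℂ)⁻¹ := by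
      field_simp
      push_cast
      ring
    rw [mul_smul_comm, hTS, smul_sub, smul_smul, h3]
  have hP0 : P = 0 := by
    ext x
    exact hker (P x) (by rw [← mul_apply_eq_comp, hTP])
  rw [hP0] at hP
  have hhalf : ‖(0 : X →L[ℂ] X)‖ < 1 / 2 := by norm_num
  obtain ⟨n, hn, hn0⟩ :=
    ((hP.norm.eventually (ge_mem_nhds hhalf)).and (eventually_gt_atTop 0)).exists
  have hn1 : (n : ℂ) ≠ 0 := by exact_mod_cast hn0.ne'
  set Q : X →L[ℂ] X := (n : ℂ)⁻¹ • ∑ k ∈ Finset.Icc 1 n, ∑ i ∈ Finset.range k, T ^ i with hQ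
  have hfac : Q * (1 - T) = 1 - (n : ℂ)⁻¹ • S n := by
    have h4 : ∀ k, (∑ i ∈ Finset.range k, T ^ i) * (1 - T) = 1 - T ^ k := fun k =>
      geom_sum_mul_neg T k
    rw [hQ, smul_mul_assoc, Finset.sum_mul]
    simp_rw [h4]
    rw [Finset.sum_sub_distrib, smul_sub, Finset.sum_const, Nat.card_Icc, Nat.add_sub_cancel,
      ← Nat.cast_smul_eq_nsmul ℂ, smul_smul, inv_mul_cancel₀ hn1, one_smul]
  refine ⟨2 * ‖Q‖, by positivity, fun x => ?_⟩
  have h5 : x = Q (x - T x) + ((n : ℂ)⁻¹ • S n) x := by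
    have h6 : Q (x - T x) = (Q * (1 - T)) x := rfl
    rw [h6, hfac]
    simp
  have h7 : ‖x‖ ≤ ‖Q‖ * ‖x - T x‖ + 1 / 2 * ‖x‖ := by
    calc ‖x‖ = ‖Q (x - T x) + ((n : ℂ)⁻¹ • S n) x‖ := by rw [← h5]
      _ ≤ ‖Q (x - T x)‖ + ‖((n : ℂ)⁻¹ • S n) x‖ := norm_add_le _ _
      _ ≤ _ := add_le_add (Q.le_opNorm _) (ContinuousLinearMap.le_of_opNorm_le _ hn x)
  linarith

end Operators

/-! ### The integration operator on the Fock space -/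

theorem integrationOp_add {f g : ℂ → ℂ} (hf : Continuous f) (hg : Continuous g) :
    integrationOp (f + g) = integrationOp f + integrationOp g := by
  ext z
  simp only [integrationOp, Pi.add_apply, add_mul]
  exact intervalIntegral.integral_add (Continuous.intervalIntegrable (by fun_prop) _ _)
    (Continuous.intervalIntegrable (by fun_prop) _ _)

theorem integrationOp_smul (c : ℂ) (f : ℂ → ℂ) :
    integrationOp (c • f) = c • integrationOp f := by
  ext z
  simp only [integrationOp, Pi.smul_apply, smul_eq_mul, mul_assoc]
  exact intervalIntegral.integral_const_mul _ _

section Fock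

variable {p : ℝ≥0∞} [hp : Fact (1 ≤ p)] {α m : ℝ}

theorem FockSpace.differentiable (f : FockSpace p α m) : Differentiable ℂ f := f.2.1

theorem FockSpace.fockENorm_ne_top (f : FockSpace p α m) : fockENorm p α m f ≠ ∞ := f.2.2.ne

theorem FockSpace.fockENorm_eq (f : FockSpace p α m) :
    fockENorm p α m f = ENNReal.ofReal ‖f‖ := by
  rw [FockSpace.norm_def, ENNReal.ofReal_toReal f.fockENorm_ne_top]

theorem FockSpace.norm_le_of_fockENorm_le {f : FockSpace p α m} {C : ℝ} (hC : 0 ≤ C)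
    (h : fockENorm p α m f ≤ ENNReal.ofReal C) : ‖f‖ ≤ C := by
  rwa [f.fockENorm_eq, ENNReal.ofReal_le_ofReal_iff hC] at h

theorem le_mul_rpow_sub_one (hα : 0 < α) (hm : 1 ≤ m) (r : ℝ) (hr : 1 ≤ r) :
    α ≤ α * r ^ (m - 1) :=
  le_mul_of_one_le_right hα.le (Real.one_le_rpow hr (by linarith))

/-- The integration operator as a bounded operator on the Fock space. -/
theorem exists_integrationCLM (hα : 0 < α) (hm : 1 ≤ m) :
    ∃ J : FockSpace p α m →L[ℂ] FockSpace p α m,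
      ∀ f : FockSpace p α m, (J f : ℂ → ℂ) = integrationOp f := by
  obtain ⟨C, hC, h⟩ := exists_fockENorm_iterate_le (R := 1) hp.out hα.le hm hα zero_le_one
    (fun r hr _ => le_mul_rpow_sub_one hα hm r hr)
  set D : ℝ≥0∞ := C * ENNReal.ofReal (rayConst α) with hD
  have hD' : D ≠ ∞ := ENNReal.mul_ne_top hC ENNReal.ofReal_ne_top
  have hJ : ∀ f : FockSpace p α m, fockENorm p α m (integrationOp f) ≤ D * fockENorm p α m f :=
    fun f => by simpa using h f f.differentiable 1
  let L : FockSpace p α m →ₗ[ℂ] FockSpace p α m :=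
    { toFun := fun f => ⟨integrationOp f, differentiable_integrationOp f.differentiable,
        (hJ f).trans_lt (ENNReal.mul_lt_top hD'.lt_top f.2.2)⟩
      map_add' := fun f g => Subtype.ext
        (integrationOp_add f.differentiable.continuous g.differentiable.continuous)
      map_smul' := fun c f => Subtype.ext (integrationOp_smul c f) }
  refine ⟨L.mkContinuous D.toReal fun f => ?_, fun f => rfl⟩
  refine FockSpace.norm_le_of_fockENorm_le (by positivity) ?_
  rw [ENNReal.ofReal_mul ENNReal.toReal_nonneg, ENNReal.ofReal_toReal hD', ← f.fockENorm_eq]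
  exact hJ f

variable {J : FockSpace p α m →L[ℂ] FockSpace p α m}

theorem coe_pow_eq_iterate (hJ : ∀ f : FockSpace p α m, (J f : ℂ → ℂ) = integrationOp f)
    (f : FockSpace p α m) (n : ℕ) : ((J ^ n) f : ℂ → ℂ) = integrationOp^[n] f := by
  induction n with
  | zero => rfl
  | succ n ih =>
    rw [Function.iterate_succ_apply', ← ih, ← hJ, pow_succ']
    rfl

theorem FockSpace.exists_norm_apply_le (hα : 0 ≤ α) (hm : 0 ≤ m) :
    ∃ C : ℝ, 0 ≤ C ∧ ∀ (f : FockSpace p α m) (z : ℂ),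
      ‖f z‖ ≤ C * Real.exp (α * (‖z‖ + 1) ^ m) * ‖f‖ := by
  set c : ℝ≥0∞ := (NNReal.pi : ℝ≥0∞) ^ (1 - 1 / p.toReal) with hc
  have hc' : c ≠ ∞ :=
    ENNReal.rpow_ne_top_of_ne_zero (by simpa using NNReal.pi_pos.ne') ENNReal.coe_ne_top
  refine ⟨c.toReal, ENNReal.toReal_nonneg, fun f z => ?_⟩
  have h := enorm_le_mul_fockENorm hp.out hα hm f.differentiable z
  rw [← hc, f.fockENorm_eq, ← ofReal_norm, ← ENNReal.ofReal_toReal hc',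
    ← ENNReal.ofReal_mul (norm_nonneg _), ← ENNReal.ofReal_mul (Real.exp_pos _).le,
    ENNReal.ofReal_le_ofReal_iff (by positivity)] at h
  calc _ ≤ _ := h
    _ = _ := by ring

theorem exists_norm_pow_le {β R : ℝ} (hα : 0 < α) (hm : 1 ≤ m) (hβ : 0 < β) (hR : 0 ≤ R)
    (hβR : ∀ r, R ≤ r → 0 < r → β ≤ α * r ^ (m - 1))
    (hJ : ∀ f : FockSpace p α m, (J f : ℂ → ℂ) = integrationOp f) :
    ∃ C : ℝ, ∀ n, ‖J ^ n‖ ≤ C * rayConst β ^ n := by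
  obtain ⟨C, hC, h⟩ := exists_fockENorm_iterate_le hp.out hα.le hm hβ hR hβR
  have hK := (rayConst_pos hβ).le
  refine ⟨C.toReal, fun n => ContinuousLinearMap.opNorm_le_bound _ (by positivity) fun f => ?_⟩
  refine FockSpace.norm_le_of_fockENorm_le (by positivity) ?_
  rw [coe_pow_eq_iterate hJ, ENNReal.ofReal_mul (by positivity),
    ENNReal.ofReal_mul ENNReal.toReal_nonneg, ENNReal.ofReal_toReal hC, ENNReal.ofReal_pow hK,
    ← f.fockENorm_eq]
  exact h f f.differentiable n

theorem exists_le_mul_rpow_sub_one (hα : 0 < α) (hm : 1 < m) (β : ℝ) :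
    ∃ R : ℝ, 0 ≤ R ∧ ∀ r, R ≤ r → 0 < r → β ≤ α * r ^ (m - 1) := by
  have h := (tendsto_rpow_atTop (by linarith : 0 < m - 1)).const_mul_atTop hα
  obtain ⟨R, hR⟩ := eventually_atTop.mp (h.eventually_ge_atTop β)
  exact ⟨max R 0, le_max_right _ _, fun r hr _ => hR r ((le_max_left _ _).trans hr)⟩

theorem forall_exists_norm_pow_le (hα : 0 < α) (hm : 1 < m)
    (hJ : ∀ f : FockSpace p α m, (J f : ℂ → ℂ) = integrationOp f) {ε : ℝ} (hε : 0 < ε) :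
    ∃ C : ℝ, ∀ n, ‖J ^ n‖ ≤ C * ε ^ n := by
  obtain ⟨β, hβε, hβ⟩ := ((tendsto_rayConst.eventually (gt_mem_nhds hε)).and
    (eventually_gt_atTop 0)).exists
  obtain ⟨R, hR, hβR⟩ := exists_le_mul_rpow_sub_one hα hm β
  obtain ⟨C, hC⟩ := exists_norm_pow_le hα hm.le hβ hR hβR hJ
  have hC0 : 0 ≤ C := by simpa using (norm_nonneg _).trans (hC 0)
  have hK := (rayConst_pos hβ).le
  exact ⟨C, fun n => (hC n).trans (by gcongr)⟩

theorem FockSpace.sub_apply (f g : FockSpace p α m) (z : ℂ) :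
    (f - g : FockSpace p α m) z = f z - g z :=
  rfl

end Fock

/-! ### Compactness for `m > 1` -/

section Compact

variable {p : ℝ≥0∞} [hp : Fact (1 ≤ p)] {α m : ℝ} {J : FockSpace p α m →L[ℂ] FockSpace p α m}

/-- A bounded sequence in the Fock space that converges to `0` locally uniformly is mapped by the
integration operator to a norm null sequence, if `m > 1`. -/
theorem tendsto_integration_of_tendstoUniformlyOn (hα : 0 < α) (hm : 1 < m)
    (hJ : ∀ f : FockSpace p α m, (J f : ℂ → ℂ) = integrationOp f) {h : ℕ → FockSpace p α m}
    {B : ℝ} (hB : ∀ n, ‖h n‖ ≤ B)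
    (hlim : ∀ R : ℝ, TendstoUniformlyOn (fun n => (h n : ℂ → ℂ)) 0 atTop (Metric.closedBall 0 R)) :
    Tendsto (fun n => J (h n)) atTop (𝓝 0) := by
  have hp1 := hp.out
  obtain ⟨C, hC, hCf⟩ := exists_rayNorm_le_mul_fockENorm hp1 hα.le (zero_le_one.trans hm.le)
  have hB0 : 0 ≤ B := (norm_nonneg _).trans (hB 0)
  refine Metric.tendsto_nhds.mpr fun ε hε => ?_
  have hlim0 : Tendsto (fun β => rayConst β * (C.toReal * B + 1)) atTop (𝓝 0) := by
    simpa using tendsto_rayConst.mul_const (C.toReal * B + 1)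
  obtain ⟨β, hβε, hβ⟩ := ((hlim0.eventually (gt_mem_nhds hε)).and (eventually_gt_atTop 0)).exists
  obtain ⟨R, hR, hβR⟩ := exists_le_mul_rpow_sub_one hα hm β
  set D : ℝ≥0∞ := rayNorm p ((Metric.closedBall (0 : ℂ) R).indicator fun _ => 1) with hD
  have hD' : D ≠ ∞ := (rayNorm_indicator_closedBall_lt_top hp1 R).ne
  -- `δ` makes the contribution of the disc of radius `R` at most `1`
  set δ : ℝ := (Real.exp (β * R) * (D.toReal + 1))⁻¹ with hδ
  have hδ0 : 0 < δ := by positivity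
  filter_upwards [Metric.tendstoUniformlyOn_iff.mp (hlim R) δ hδ0] with n hn
  have hK := rayConst_pos hβ
  rw [dist_zero_right]
  refine lt_of_le_of_lt (FockSpace.norm_le_of_fockENorm_le (by positivity) ?_) hβε
  rw [hJ]
  have hM : ∀ z, ‖z‖ ≤ R → ‖h n z‖ₑ ≤ ENNReal.ofReal δ := fun z hz => by
    have h1 := hn z (by simpa using hz)
    rw [dist_comm, Pi.zero_apply, dist_zero_right] at h1
    rw [← ofReal_norm]
    exact ENNReal.ofReal_le_ofReal h1.le
  refine (fockENorm_integrationOp_le hp1 hα.le hm.le hβ hβR (h n).differentiable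
    ENNReal.ofReal_ne_top hM).trans ?_
  rw [ENNReal.ofReal_mul hK.le]
  gcongr
  rw [ENNReal.ofReal_add (by positivity) zero_le_one, ENNReal.ofReal_mul ENNReal.toReal_nonneg,
    ENNReal.ofReal_toReal hC]
  gcongr
  · refine (hCf _ (h n).differentiable).trans ?_
    rw [(h n).fockENorm_eq]
    gcongr
    exact hB n
  · rw [← hD, ← ENNReal.ofReal_toReal hD', ← ENNReal.ofReal_mul (by positivity),
      ← ENNReal.ofReal_mul (by positivity)]
    refine ENNReal.ofReal_le_ofReal ?_
    rw [hδ, mul_inv, mul_inv_cancel_left₀ (Real.exp_pos _).ne', inv_mul_le_iff₀ (by positivity)]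
    linarith

/-- The image of the closed unit ball is sequentially compact: by Montel's theorem a sequence in
the ball has a locally uniformly convergent subsequence, its limit is in the ball by Fatou's
lemma, and the integration operator turns this convergence into norm convergence. -/
theorem isCompactOperator_integration (hα : 0 < α) (hm : 1 < m)
    (hJ : ∀ f : FockSpace p α m, (J f : ℂ → ℂ) = integrationOp f) : IsCompactOperator J := by
  have hp1 := hp.out
  have hp0 : p ≠ 0 := (zero_lt_one.trans_le hp1).ne'
  refine ⟨J '' Metric.closedBall 0 1, IsSeqCompact.isCompact fun y hy => ?_,
    mem_of_superset (Metric.closedBall_mem_nhds 0 one_pos) (Set.subset_preimage_image _ _)⟩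
  choose f hf hfy using hy
  have hf1 : ∀ n, ‖f n‖ ≤ 1 := fun n => by simpa using hf n
  obtain ⟨C, hC, hCf⟩ := FockSpace.exists_norm_apply_le (p := p) hα.le (zero_le_one.trans hm.le)
  obtain ⟨g, hg, φ, hφ, hlim⟩ := exists_subseq_tendstoUniformlyOn_closedBall
    (f := fun n => (f n : ℂ → ℂ)) (fun n => (f n).differentiable) fun R =>
      ⟨C * Real.exp (α * (R + 1) ^ m), fun n z hz => by
        calc ‖f n z‖ ≤ C * Real.exp (α * (‖z‖ + 1) ^ m) * ‖f n‖ := hCf _ z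
          _ ≤ C * Real.exp (α * (R + 1) ^ m) * 1 := by gcongr; exact hf1 n
          _ = _ := mul_one _⟩
  have hpt : ∀ z, Tendsto (fun n => f (φ n) z) atTop (𝓝 (g z)) := fun z =>
    (hlim ‖z‖).tendsto_at (by simp)
  have hgn : fockENorm p α m g ≤ ENNReal.ofReal 1 := by
    rw [fockENorm_eq_eLpNorm hp0 α m hg.continuous]
    refine (Lp.eLpNorm_lim_le_liminf_eLpNorm
      (f := fun n => fockWeighted α m (f (φ n)))
      (fun n => aestronglyMeasurable_fockWeighted α m (f (φ n)).differentiable.continuous) _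
      (ae_of_all _ fun z => (hpt z).const_mul _)).trans ?_
    refine liminf_le_of_le (by isBoundedDefault) fun b hb => ?_
    obtain ⟨n, hn⟩ := hb.exists
    refine hn.trans ?_
    rw [← fockENorm_eq_eLpNorm hp0 α m (f (φ n)).differentiable.continuous, (f (φ n)).fockENorm_eq]
    exact ENNReal.ofReal_le_ofReal (hf1 _)
  let G : FockSpace p α m := ⟨g, hg, hgn.trans_lt ENNReal.ofReal_lt_top⟩
  have hG1 : ‖G‖ ≤ 1 := FockSpace.norm_le_of_fockENorm_le (f := G) zero_le_one hgn
  refine ⟨J G, Set.mem_image_of_mem _ (by simpa using hG1), φ, hφ, ?_⟩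
  have h1 : Tendsto (fun n => J (f (φ n) - G)) atTop (𝓝 0) := by
    refine tendsto_integration_of_tendstoUniformlyOn (B := 2) hα hm hJ (fun n => ?_) fun R => ?_
    · linarith [norm_sub_le (f (φ n)) G, hf1 (φ n)]
    · refine Metric.tendstoUniformlyOn_iff.mpr fun ε hε => ?_
      filter_upwards [Metric.tendstoUniformlyOn_iff.mp (hlim R) ε hε] with n hn z hz
      have h2 := hn z hz
      rw [dist_comm, dist_eq_norm] at h2
      rw [Pi.zero_apply, dist_zero_left, FockSpace.sub_apply]
      exact h2
  have h3 := h1.add_const (J G)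
  rw [zero_add] at h3
  refine h3.congr fun n => ?_
  rw [Function.comp_apply, ← hfy, map_sub, sub_add_cancel]

end Compact

/-! ### The case `m = 1` -/

section Exponential

variable {p : ℝ≥0∞} [hp : Fact (1 ≤ p)] {α : ℝ}

theorem lintegral_exp_neg_mul_norm_lt_top {c : ℝ} (hc : 0 < c) :
    ∫⁻ z : ℂ, ENNReal.ofReal (Real.exp (-(c * ‖z‖))) < ∞ := by
  have hm : Measurable fun z : ℂ => ENNReal.ofReal (Real.exp (-(c * ‖z‖))) := by fun_prop
  rw [lintegral_polar hm]
  calc _ ≤ ∫⁻ _ in Set.Ioo (-Real.pi) Real.pi,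
        ENNReal.ofReal (rayConst c) * ENNReal.ofReal (1 + 0) := by
        refine lintegral_mono fun θ => ?_
        refine le_trans ?_ (lintegral_exp_neg_mul_sub_Ici_le hc le_rfl)
        refine (setLIntegral_mono' measurableSet_Ioi fun r hr => ?_).trans
          (lintegral_mono_set Set.Ioi_subset_Ici_self)
        have hr0 : (0 : ℝ) < r := hr
        rw [norm_mul, norm_cos_add_sin_mul_I, mul_one, Complex.norm_real,
          Real.norm_of_nonneg hr0.le, mul_comm, sub_zero]
        gcongr
        linarith
    _ < ∞ := by
        rw [lintegral_const, Measure.restrict_apply_univ, Real.volume_Ioo]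
        finiteness

/-- For `m = 1`, functions of exponential type less than `α` belong to the Fock space. -/
theorem fockENorm_lt_top_of_norm_le {f : ℂ → ℂ} {C l : ℝ} (hl : l < α)
    (hf : ∀ z, ‖f z‖ ≤ C * Real.exp (l * ‖z‖)) : fockENorm p α 1 f < ∞ := by
  have hC : 0 ≤ C := by simpa using (norm_nonneg _).trans (hf 0)
  have hw : ∀ z, Real.exp (-(α * ‖z‖)) * ‖f z‖ ≤ C * Real.exp (-((α - l) * ‖z‖)) := fun z => by
    calc _ ≤ Real.exp (-(α * ‖z‖)) * (C * Real.exp (l * ‖z‖)) := by gcongr; exact hf z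
      _ = C * Real.exp (-((α - l) * ‖z‖)) := by
        rw [mul_left_comm, ← Real.exp_add]; ring_nf
  unfold fockENorm
  simp only [Real.rpow_one]
  split_ifs with h
  · refine lt_of_le_of_lt (iSup₂_le fun z _ => ENNReal.ofReal_le_ofReal (q := C) ?_)
      ENNReal.ofReal_lt_top
    refine (hw z).trans (mul_le_of_le_one_right hC (Real.exp_le_one_iff.mpr ?_))
    have : 0 ≤ (α - l) * ‖z‖ := mul_nonneg (by linarith) (norm_nonneg z)
    linarith
  · have hq := one_le_toReal hp.out h
    refine ENNReal.rpow_lt_top_of_nonneg (by positivity) (ne_of_lt ?_)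
    calc _ ≤ ∫⁻ z : ℂ, ENNReal.ofReal (C ^ p.toReal) *
          ENNReal.ofReal (Real.exp (-((p.toReal * (α - l)) * ‖z‖))) := by
          refine lintegral_mono fun z => ?_
          rw [← ENNReal.ofReal_mul (by positivity)]
          refine ENNReal.ofReal_le_ofReal ?_
          have h1 := Real.rpow_le_rpow (by positivity) (hw z) (by linarith : 0 ≤ p.toReal)
          rw [Real.mul_rpow (by positivity) (by positivity),
            Real.mul_rpow hC (by positivity), ← Real.exp_mul, ← Real.exp_mul] at h1
          calc _ = Real.exp (-(α * ‖z‖) * p.toReal) * ‖f z‖ ^ p.toReal := by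
                rw [mul_comm]; ring_nf
            _ ≤ _ := h1
            _ = _ := by ring_nf
      _ < ∞ := by
          rw [lintegral_const_mul' _ _ ENNReal.ofReal_ne_top]
          exact ENNReal.mul_lt_top ENNReal.ofReal_lt_top (lintegral_exp_neg_mul_norm_lt_top
            (mul_pos (by linarith) (by linarith)))

variable {J : FockSpace p α 1 →L[ℂ] FockSpace p α 1}

theorem exists_coe_eq_one (hα : 0 < α) : ∃ f : FockSpace p α 1, (f : ℂ → ℂ) = fun _ => 1 :=
  ⟨⟨fun _ => 1, differentiable_const 1,
    fockENorm_lt_top_of_norm_le (C := 1) hα fun z => by simp⟩, rfl⟩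

theorem norm_exp_ofReal_mul_le {l : ℝ} (hl : 0 ≤ l) (z : ℂ) :
    ‖Complex.exp (l * z)‖ ≤ Real.exp (l * ‖z‖) := by
  rw [Complex.norm_exp, Real.exp_le_exp, Complex.re_ofReal_mul]
  exact mul_le_mul_of_nonneg_left (Complex.re_le_norm z) hl

theorem exists_coe_eq_exp {l : ℝ} (hl : 0 ≤ l) (hlα : l < α) :
    ∃ f : FockSpace p α 1, (f : ℂ → ℂ) = fun z => Complex.exp (l * z) :=
  ⟨⟨fun z => Complex.exp (l * z), by fun_prop,
    fockENorm_lt_top_of_norm_le (C := 1) hlα fun z => by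
      rw [one_mul]; exact norm_exp_ofReal_mul_le hl z⟩, rfl⟩

theorem exists_coe_eq_mul_exp {l : ℝ} (hl : 0 ≤ l) (hlα : l < α) :
    ∃ f : FockSpace p α 1, (f : ℂ → ℂ) = fun z => z * Complex.exp (l * z) := by
  set d := (α - l) / 2 with hd
  have hd0 : 0 < d := by rw [hd]; linarith
  refine ⟨⟨fun z => z * Complex.exp (l * z), by fun_prop,
    fockENorm_lt_top_of_norm_le (C := 1 / d) (l := l + d) (by rw [hd]; linarith)
      fun z => ?_⟩, rfl⟩
  rw [norm_mul, add_mul, Real.exp_add, one_div, ← mul_assoc, mul_comm d⁻¹, mul_assoc, mul_comm]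
  gcongr
  · exact norm_exp_ofReal_mul_le hl z
  · rw [le_inv_mul_iff₀ hd0]
    linarith [Real.add_one_le_exp (d * ‖z‖)]

theorem iterate_integrationOp_one (n : ℕ) :
    integrationOp^[n] (fun _ => 1) = fun z : ℂ => z ^ n / (n.factorial : ℂ) := by
  induction n with
  | zero => ext; simp
  | succ n ih =>
    rw [Function.iterate_succ_apply', ih]
    ext z
    have hn : (n.factorial : ℂ) ≠ 0 := by exact_mod_cast n.factorial_ne_zero
    have hn1 : ((n : ℂ) + 1) ≠ 0 := by exact_mod_cast n.succ_ne_zero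
    rw [integrationOp_eq_sub (F := fun z => z ^ (n + 1) / ((n + 1).factorial : ℂ)) (fun w => ?_)
      (by fun_prop)]
    · simp
    · have h := (hasDerivAt_pow (n + 1) w).div_const ((n + 1).factorial : ℂ)
      refine h.congr_deriv ?_
      rw [Nat.factorial_succ]
      push_cast
      field_simp

/-- Applied to the constant function `1`, the powers give `z ^ n / n!`. If `‖J ^ n‖` grows at most
linearly, summation against `l ^ n` gives `exp (l r) ≤ C exp (α r)` for all `l < 1`. -/
theorem one_le_of_norm_pow_le (hα : 0 < α)
    (hJ : ∀ f : FockSpace p α 1, (J f : ℂ → ℂ) = integrationOp f) {C : ℝ}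
    (hC : ∀ n : ℕ, ‖J ^ n‖ ≤ C * (n + 1)) : 1 ≤ α := by
  by_contra! hα1
  obtain ⟨l, hl, hl1⟩ := exists_between hα1
  have hl0 : 0 < l := hα.trans hl
  obtain ⟨e, he⟩ := exists_coe_eq_one (p := p) hα
  obtain ⟨D, hD, hDf⟩ := FockSpace.exists_norm_apply_le (p := p) (m := 1) hα.le zero_le_one
  have hpow : ∀ (n : ℕ) (r : ℝ), 0 ≤ r →
      r ^ n / n.factorial ≤ D * Real.exp (α * (r + 1)) * (C * ‖e‖) * (n + 1) := fun n r hr => by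
    have h1 := hDf ((J ^ n) e) r
    rw [coe_pow_eq_iterate hJ, he, iterate_integrationOp_one, norm_div, norm_pow,
      Complex.norm_natCast, Complex.norm_real, Real.norm_of_nonneg hr, Real.rpow_one] at h1
    calc _ ≤ _ := h1
      _ ≤ D * Real.exp (α * (r + 1)) * (C * (n + 1) * ‖e‖) := by
          gcongr
          exact ContinuousLinearMap.le_of_opNorm_le _ (hC n) e
      _ = _ := by ring
  have hs : Summable fun n : ℕ => ((n : ℝ) + 1) * l ^ n := by
    have h2 : Summable fun n : ℕ => (n : ℝ) ^ 1 * l ^ n :=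
      summable_pow_mul_geometric_of_norm_lt_one 1 (by rwa [Real.norm_of_nonneg hl0.le])
    have h3 := h2.add (summable_geometric_of_lt_one hl0.le hl1)
    exact h3.congr fun n => by ring
  set S := ∑' n : ℕ, ((n : ℝ) + 1) * l ^ n with hS
  have hexp : ∀ r : ℝ, 0 ≤ r →
      Real.exp (l * r) ≤ D * Real.exp (α * (r + 1)) * (C * ‖e‖) * S := fun r hr => by
    have h4 : HasSum (fun n : ℕ => (l * r) ^ n / n.factorial) (Real.exp (l * r)) := by
      rw [Real.exp_eq_exp_ℝ]
      exact NormedSpace.expSeries_div_hasSum_exp (l * r)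
    refine hasSum_le (fun n => ?_) h4 (hs.hasSum.mul_left _)
    calc (l * r) ^ n / n.factorial = l ^ n * (r ^ n / n.factorial) := by rw [mul_pow]; ring
      _ ≤ l ^ n * (D * Real.exp (α * (r + 1)) * (C * ‖e‖) * (n + 1)) := by
          gcongr; exact hpow n r hr
      _ = _ := by ring
  have hbd : ∀ r : ℝ, 0 ≤ r →
      Real.exp ((l - α) * r) ≤ D * Real.exp α * (C * ‖e‖) * S := fun r hr => by
    have h5 := hexp r hr
    have h6 : Real.exp (l * r) = Real.exp ((l - α) * r) * Real.exp (α * r) := by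
      rw [← Real.exp_add]; ring_nf
    have h7 : Real.exp (α * (r + 1)) = Real.exp α * Real.exp (α * r) := by
      rw [← Real.exp_add]; ring_nf
    rw [h6, h7] at h5
    refine le_of_mul_le_mul_right (h5.trans (le_of_eq ?_)) (Real.exp_pos (α * r))
    ring
  have htop : Tendsto (fun r : ℝ => Real.exp ((l - α) * r)) atTop atTop :=
    Real.tendsto_exp_atTop.comp (tendsto_id.const_mul_atTop (by linarith))
  obtain ⟨r, hr, hr0⟩ := ((htop.eventually_gt_atTop (D * Real.exp α * (C * ‖e‖) * S)).and
    (eventually_ge_atTop 0)).exists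
  exact absurd (hbd r hr0) (not_le.mpr hr)

/-- The integration operator has no nonzero fixed point: it would be a multiple of `exp` that
vanishes at `0`. -/
theorem eq_zero_of_integrationOp_eq {f : ℂ → ℂ} (hf : Differentiable ℂ f)
    (h : integrationOp f = f) : f = 0 := by
  have hd : ∀ z, HasDerivAt f (f z) z := fun z => by
    have := hasDerivAt_integrationOp hf z
    rwa [h] at this
  have hd2 : ∀ z, HasDerivAt (fun z => f z * Complex.exp (-z)) 0 z := fun z => by
    have h1 := (hd z).mul (hasDerivAt_neg z).cexp
    refine h1.congr_deriv ?_
    ring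
  ext z
  have h0 : f 0 = 0 := by
    rw [← h]
    simp [integrationOp]
  have h2 := is_const_of_deriv_eq_zero (fun z => (hd2 z).differentiableAt)
    (fun z => (hd2 z).deriv) z 0
  simp only [h0, zero_mul] at h2
  simpa [Complex.exp_ne_zero] using h2

theorem integrationOp_exp {l : ℂ} (hl : l ≠ 0) (z : ℂ) :
    integrationOp (fun z => Complex.exp (l * z)) z = l⁻¹ * (Complex.exp (l * z) - 1) := by
  rw [integrationOp_eq_sub (F := fun z => l⁻¹ * Complex.exp (l * z)) (fun w => ?_) (by fun_prop)]
  · simp; ring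
  · have h := (((hasDerivAt_id w).const_mul l).cexp).const_mul l⁻¹
    refine h.congr_deriv ?_
    simp only [id, mul_one]
    field_simp

theorem integrationOp_mul_exp {l : ℂ} (hl : l ≠ 0) (z : ℂ) :
    integrationOp (fun z => z * Complex.exp (l * z)) z
      = l⁻¹ * (z * Complex.exp (l * z)) - l⁻¹ ^ 2 * (Complex.exp (l * z) - 1) := by
  rw [integrationOp_eq_sub
    (F := fun z => l⁻¹ * (z * Complex.exp (l * z)) - l⁻¹ ^ 2 * (Complex.exp (l * z) - 1))
    (fun w => ?_) (by fun_prop)]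
  · simp
  · have h0 := ((hasDerivAt_id w).const_mul l).cexp
    have h := (((hasDerivAt_id w).mul h0).const_mul l⁻¹).sub ((h0.sub_const 1).const_mul (l⁻¹ ^ 2))
    refine h.congr_deriv ?_
    simp only [id, mul_one]
    field_simp
    ring

/-- For `α = 1` the operator `1 - J` is not bounded below. Otherwise testing first with
`exp (l z)` and then with `z exp (l z)`, `l → 1`, would give a uniform bound for the norms of
both families, although `z exp z` exceeds the growth `C exp |z|` allowed by point evaluations. -/
theorem not_isUniformlyMeanErgodic_of_eq_one {J : FockSpace p 1 1 →L[ℂ] FockSpace p 1 1}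
    (hJ : ∀ f : FockSpace p 1 1, (J f : ℂ → ℂ) = integrationOp f) :
    ¬ IsUniformlyMeanErgodic J := by
  intro hU
  obtain ⟨C, hC, hbelow⟩ := hU.exists_norm_le fun f hf => Subtype.ext
    (eq_zero_of_integrationOp_eq f.differentiable (by rw [← hJ, hf]))
  obtain ⟨e, he⟩ := exists_coe_eq_one (p := p) one_pos
  obtain ⟨D, hD, hDf⟩ := FockSpace.exists_norm_apply_le (p := p) (α := 1) (m := 1)
    zero_le_one zero_le_one
  set E : ℝ := ‖e‖ with hE
  have hE0 : 0 ≤ E := norm_nonneg _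
  have habs : ∀ x b d : ℝ, 0 ≤ x → C * d ≤ 1 / 2 → x ≤ C * (d * x + b) → x ≤ 2 * C * b :=
    fun x b d hx hd h => by nlinarith
  -- for `l` close to `1` the term `(1 / l - 1) ‖f‖` can be absorbed
  have hkey : ∀ l : ℝ, 1 / 2 ≤ l → l < 1 → C * (l⁻¹ - 1) ≤ 1 / 2 → ∀ r : ℝ, 0 ≤ r →
      r * Real.exp (l * r) ≤ D * Real.exp (r + 1) * (2 * C * (4 * (4 * C * E + E))) := by
    intro l hl hl1 hCl r hr
    have hl0 : 0 < l := by linarith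
    have hlc : (l : ℂ) ≠ 0 := by exact_mod_cast hl0.ne'
    have hinv : l⁻¹ ≤ 2 := by rw [inv_le_comm₀ hl0 two_pos]; linarith
    have hinv1 : 1 ≤ l⁻¹ := (one_le_inv₀ hl0).mpr hl1.le
    have hnorm1 : ‖(1 : ℂ) - (l : ℂ)⁻¹‖ = l⁻¹ - 1 := by
      rw [← Complex.ofReal_inv, ← Complex.ofReal_one, ← Complex.ofReal_sub, Complex.norm_real,
        Real.norm_of_nonpos (by linarith)]
      ring
    have hnorm2 : ‖(l : ℂ)⁻¹‖ = l⁻¹ := by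
      rw [← Complex.ofReal_inv, Complex.norm_real, Real.norm_of_nonneg (by positivity)]
    obtain ⟨f, hf⟩ := exists_coe_eq_exp (p := p) hl0.le hl1
    obtain ⟨g, hg⟩ := exists_coe_eq_mul_exp (p := p) hl0.le hl1
    have hf1 : f - J f = (1 - (l : ℂ)⁻¹) • f + (l : ℂ)⁻¹ • e := by
      refine Subtype.ext (funext fun z => ?_)
      change f z - J f z = (1 - (l : ℂ)⁻¹) * f z + (l : ℂ)⁻¹ * e z
      rw [hJ, hf, he, integrationOp_exp hlc]
      ring
    have hg1 : g - J g = (1 - (l : ℂ)⁻¹) • g + (l : ℂ)⁻¹ ^ 2 • (f - e) := by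
      refine Subtype.ext (funext fun z => ?_)
      change g z - J g z = (1 - (l : ℂ)⁻¹) * g z + (l : ℂ)⁻¹ ^ 2 * (f z - e z)
      rw [hJ, hg, hf, he, integrationOp_mul_exp hlc]
      ring
    have hfn : ‖f‖ ≤ 4 * C * E := by
      have h1 : ‖f‖ ≤ C * ((l⁻¹ - 1) * ‖f‖ + 2 * E) := by
        refine (hbelow f).trans ?_
        gcongr
        rw [hf1]
        refine (norm_add_le _ _).trans ?_
        rw [norm_smul, norm_smul, hnorm1, hnorm2]
        gcongr
      linarith [habs _ _ _ (norm_nonneg f) hCl h1]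
    have hgn : ‖g‖ ≤ 2 * C * (4 * (4 * C * E + E)) := by
      refine habs _ _ _ (norm_nonneg g) hCl ?_
      refine (hbelow g).trans ?_
      gcongr
      rw [hg1]
      refine (norm_add_le _ _).trans ?_
      rw [norm_smul, norm_smul, hnorm1, norm_pow, hnorm2]
      gcongr
      · nlinarith
      · exact (norm_sub_le f e).trans (by linarith)
    have h2 := hDf g r
    rw [hg, Real.rpow_one, norm_mul, Complex.norm_real, Real.norm_of_nonneg hr, one_mul,
      Complex.norm_exp, Complex.re_ofReal_mul, Complex.ofReal_re] at h2
    exact h2.trans (by gcongr)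
  set A := 2 * C * (4 * (4 * C * E + E)) with hA
  have hlim : ∀ r : ℝ, 0 ≤ r → r ≤ D * Real.exp 1 * A := fun r hr => by
    have hcont : Tendsto (fun l : ℝ => r * Real.exp (l * r)) (𝓝[<] 1) (𝓝 (r * Real.exp (1 * r))) :=
      ((by fun_prop : Continuous fun l : ℝ => r * Real.exp (l * r)).tendsto 1).mono_left
        nhdsWithin_le_nhds
    have hsmall : Tendsto (fun l : ℝ => C * (l⁻¹ - 1)) (𝓝[<] 1) (𝓝 (C * ((1 : ℝ)⁻¹ - 1))) :=
      (((tendsto_inv₀ one_ne_zero).sub_const 1).const_mul C).mono_left nhdsWithin_le_nhds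
    rw [inv_one, sub_self, mul_zero] at hsmall
    have h3 : r * Real.exp (1 * r) ≤ D * Real.exp (r + 1) * A := by
      refine le_of_tendsto hcont ?_
      filter_upwards [hsmall.eventually (ge_mem_nhds (by norm_num : (0 : ℝ) < 1 / 2)),
        Ioo_mem_nhdsLT (by norm_num : (1 / 2 : ℝ) < 1)] with l h4 h5
      exact hkey l h5.1.le h5.2 h4 r hr
    refine le_of_mul_le_mul_right (h3.trans (le_of_eq ?_)) (Real.exp_pos (1 * r))
    rw [Real.exp_add, one_mul]
    ring
  have hA0 : 0 ≤ D * Real.exp 1 * A := by positivity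
  linarith [hlim (D * Real.exp 1 * A + 1) (by linarith)]

theorem one_lt_of_isUniformlyMeanErgodic (hα : 0 < α)
    (hJ : ∀ f : FockSpace p α 1, (J f : ℂ → ℂ) = integrationOp f)
    (h : IsUniformlyMeanErgodic J) : 1 < α := by
  obtain ⟨C, hC⟩ := h.norm_pow_le
  rcases (one_le_of_norm_pow_le hα hJ hC).lt_or_eq with h1 | h1
  · exact h1
  · subst h1
    exact absurd h (not_isUniformlyMeanErgodic_of_eq_one hJ)

theorem one_le_of_isPowerBounded (hα : 0 < α)
    (hJ : ∀ f : FockSpace p α 1, (J f : ℂ → ℂ) = integrationOp f)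
    (h : IsPowerBounded J) : 1 ≤ α := by
  obtain ⟨M, hM, h⟩ := h
  refine one_le_of_norm_pow_le hα hJ (C := M) fun n => (h n).trans ?_
  exact le_mul_of_one_le_right hM.le (by linarith [Nat.cast_nonneg (α := ℝ) n])

end Exponential

/-! ### The sharp norm bound for `p = ∞`, `m = 1` -/

/-- For `p = ∞` and `m = 1` the integration operator has norm at most `1 / α`. -/
theorem norm_integration_le_of_top {α : ℝ} [Fact (1 ≤ (∞ : ℝ≥0∞))] (hα : 0 < α)
    {J : FockSpace ∞ α 1 →L[ℂ] FockSpace ∞ α 1}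
    (hJ : ∀ f : FockSpace ∞ α 1, (J f : ℂ → ℂ) = integrationOp f) : ‖J‖ ≤ 1 / α := by
  have hw : ∀ (f : ℂ → ℂ) (z : ℂ), ‖fockWeighted α 1 f z‖ₑ = tiltedModulus α 1 α 0 f z :=
    fun f z => by
      rw [enorm_fockWeighted, tiltedModulus, min_eq_right (norm_nonneg z), mul_zero, add_zero]
  refine ContinuousLinearMap.opNorm_le_bound _ (by positivity) fun f => ?_
  refine FockSpace.norm_le_of_fockENorm_le (by positivity) ?_
  rw [ENNReal.ofReal_mul (by positivity), ← f.fockENorm_eq, hJ, ← rayNorm_top_fockWeighted,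
    ← rayNorm_top_fockWeighted]
  simp_rw [hw]
  exact rayNorm_top_le hα fun r hr ω hω => tiltedModulus_integrationOp_le hα.le le_rfl hα.le
    (fun r _ _ => by simp) _ hr hω

theorem norm_pow_integration_le_of_top {α : ℝ} [Fact (1 ≤ (∞ : ℝ≥0∞))] (hα : 0 < α)
    {J : FockSpace ∞ α 1 →L[ℂ] FockSpace ∞ α 1}
    (hJ : ∀ f : FockSpace ∞ α 1, (J f : ℂ → ℂ) = integrationOp f) (n : ℕ) :
    ‖J ^ n‖ ≤ 1 * (1 / α) ^ n := by
  rw [one_mul]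
  rcases Nat.eq_zero_or_pos n with rfl | hn
  · rw [pow_zero, pow_zero]
    exact ContinuousLinearMap.norm_id_le
  · exact (norm_pow_le' J hn).trans (by gcongr; exact norm_integration_le_of_top hα hJ)

theorem corollary3p4 (p : ℝ≥0∞) [Fact (1 ≤ p)] (α m : ℝ) (hα : 0 < α) (hm : 1 ≤ m) :
    ∃ J : FockSpace p α m →L[ℂ] FockSpace p α m,
      (∀ (f : FockSpace p α m) (z : ℂ), J f z = integrationOp f z) ∧
      (1 < m → IsCompactOperator J ∧ IsQuasiNilpotent J ∧ IsPowerBounded J ∧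
        IsUniformlyMeanErgodic J) ∧
      (m = 1 → p = ∞ → (IsPowerBounded J ↔ 1 ≤ α)) ∧
      (m = 1 → p = ∞ → (IsUniformlyMeanErgodic J ↔ 1 < α)) ∧
      (m = 1 → p < ∞ → IsPowerBounded J → 1 ≤ α) ∧
      (m = 1 → p < ∞ → IsPowerBounded J ∧ IsUniformlyMeanErgodic J → 1 < α) := by
  obtain ⟨J, hJ⟩ := exists_integrationCLM (p := p) hα hm
  refine ⟨J, fun f z => congrFun (hJ f) z, fun hm1 => ?_, ?_, ?_, ?_, ?_⟩
  · have hgeo := fun ε hε => forall_exists_norm_pow_le (ε := ε) hα hm1 hJ hε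
    obtain ⟨C, hC⟩ := hgeo (1 / 2) (by norm_num)
    have hs := summable_norm_pow_of_le_geometric (by norm_num) (by norm_num) hC
    exact ⟨isCompactOperator_integration hα hm1 hJ, isQuasiNilpotent_of_forall_le_geometric hgeo,
      isPowerBounded_of_summable hs, isUniformlyMeanErgodic_of_summable hs⟩
  · rintro rfl rfl
    refine ⟨one_le_of_isPowerBounded hα hJ, fun h => ⟨1, one_pos, fun n => ?_⟩⟩
    refine (norm_pow_integration_le_of_top hα hJ n).trans ?_
    rw [one_mul]
    exact pow_le_one₀ (by positivity) ((div_le_one hα).mpr h)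
  · rintro rfl rfl
    refine ⟨one_lt_of_isUniformlyMeanErgodic hα hJ, fun h => ?_⟩
    exact isUniformlyMeanErgodic_of_summable (summable_norm_pow_of_le_geometric (by positivity)
      ((div_lt_one hα).mpr h) (norm_pow_integration_le_of_top hα hJ))
  · rintro rfl -
    exact one_le_of_isPowerBounded hα hJ
  · rintro rfl - h
    exact one_lt_of_isUniformlyMeanErgodic hα hJ h.2
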